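/- **Conventions.** Theories are one-sorted first-order theories in a finite signature. The theorems of a theory are its logical consequences in its own language. Sentences are identified with their Gödel numbers. A theory is RE, respectively decidable, if its set of theorems is. The Turing degree of a theory is the degree of its set of theorems. A theory $U$ is *essentially undecidable* if every consistent extension of $U$ in the same language is undecidable. A theory $U$ is *Turing-persistent* if it is RE and consistent and $U\leq_{\mathsf T}V$ for every consistent RE theory $V$, possibly in a larger finite signature, with $U\subseteq V$ (as sets of theorems). Let $\mathsf J$ be the theory in the language with one binary relation symbol $\mathsf E$ (and equality) with the axioms: $\mathsf E$ is an equivalence relation; and, for every $n$, there is at most one equivalence class of size precisely $n$, and there are at least $n$ equivalence classes with at least $n$ elements. Let $\mathsf A_n$ be the sentence "there is an equivalence class of size precisely $n+1$". Let $\mathsf T_1(e,x,y)$ be Kleene's predicate "$y$ is the computation of the $e$-th partial recursive function on input $x$, and it halts" (so $y$ is unique when it exists), taking as the computation $y$ the least resource bound that suffices for it, and let $\mathcal W_e=\{x\mid \exists y\,\mathsf T_1(e,x,y)\}$ be the RE set with index $e$. Write $x=\langle (x)_0,(x)_1\rangle$ for a recursive pairing bijection. For an index $a$, put $\mathcal A=\mathcal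 W_a$ and $$\mathcal B=\{x\mid \exists y\,(\mathsf T_1(a,(x)_0,y)\wedge\forall z\leq y\;\neg\,\mathsf T_1((x)_1,x,z))\},$$ $$\mathcal C=\{x\mid (x)_0\in\mathcal A\ \wedge\ \exists z\,(\mathsf T_1((x)_1,x,z)\wedge\forall y<z\;\neg\,\mathsf T_1(a,(x)_0,y))\},$$ $$\mathsf{sch}(a)=\mathsf J+\{\mathsf A_n\mid n\in\mathcal B\}+\{\neg\,\mathsf A_m\mid m\in\mathcal C\}.$$ **Theorem (Shoenfield).** For every index $a$, with $\mathcal A=\mathcal W_a$: 1. the theory $\mathsf{sch}(a)$ has the same Turing degree as $\mathcal A$; 2. $\mathsf{sch}(a)$ is Turing-persistent; 3. if $\mathcal A$ is undecidable, then $\mathsf{sch}(a)$ is essentially undecidable. Consequently, every non-recursive RE Turing degree contains a consistent, essentially undecidable RE theory. -/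

import Mathlib

namespace Shoenfield

open FirstOrder FirstOrder.Language

/-! ### Recursion theory -/

/-- The characteristic function of a set of numbers, as a (total) partial function. -/
noncomputable def chi (S : Set ℕ) : ℕ →. ℕ :=
  open Classical in fun n => Part.some (if n ∈ S then 1 else 0)

/-- Turing reducibility of sets of numbers. -/
def SetTuringReducible (S T : Set ℕ) : Prop := TuringReducible (chi S) (chi T)

/-- The Turing degree of a set of numbers. -/
noncomputable def degree (S : Set ℕ) : TuringDegree :=
  toAntisymmetrization TuringReducible (chi S)

/-- The set is decidable (recursive). -/
def IsRecursive (S : Set ℕ) : Prop := ComputablePred fun n => n ∈ S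

/-- The set is recursively enumerable. -/
def IsRE (S : Set ℕ) : Prop := REPred fun n => n ∈ S

/-- The recursively enumerable set with index `e`: the domain of the `e`-th partial recursive
function. -/
def W (e : ℕ) : Set ℕ :=
  {x | ((Denumerable.ofNat Nat.Partrec.Code e).eval x).Dom}

/-- Kleene's predicate `T₁(e, x, y)`: the computation of the `e`-th partial recursive function on
input `x` halts, and its code is `y`. As the code of a halting computation we take the least
resource bound that suffices for it, so that `y` is unique when it exists. -/
def T1 (e x y : ℕ) : Prop :=
  (Nat.Partrec.Code.evaln y (Denumerable.ofNat Nat.Partrec.Code e) x).isSome ∧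
    ∀ y' < y, ¬ (Nat.Partrec.Code.evaln y' (Denumerable.ofNat Nat.Partrec.Code e) x).isSome

theorem mem_W_iff (e x : ℕ) : x ∈ W e ↔ ∃ y, T1 e x y := by
  classical
  have h : x ∈ W e ↔
      ∃ y, (Nat.Partrec.Code.evaln y (Denumerable.ofNat Nat.Partrec.Code e) x).isSome := by
    simp only [W, Set.mem_ofPred_eq, Part.dom_iff_mem, Nat.Partrec.Code.evaln_complete,
      Option.isSome_iff_exists, Option.mem_def]
    exact exists_comm
  rw [h]
  constructor
  · intro hy
    exact ⟨Nat.find hy, Nat.find_spec hy, fun y' hy' => Nat.find_min hy hy'⟩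
  · rintro ⟨y, hy, -⟩
    exact ⟨y, hy⟩

/-- `x ∈ ℬ` iff `((x)₀ ∈ 𝒜) < (x ∈ Z)`, where `𝒜 = W a` and `x ∈ Z` iff `∃ z, T₁((x)₁, x, z)`. -/
def setB (a : ℕ) : Set ℕ :=
  {x | ∃ y, T1 a x.unpair.1 y ∧ ∀ z ≤ y, ¬ T1 x.unpair.2 x z}

/-- `x ∈ ℬ^⊥` iff `(x ∈ Z) ≤ ((x)₀ ∈ 𝒜)`. -/
def setBperp (a : ℕ) : Set ℕ :=
  {x | ∃ z, T1 x.unpair.2 x z ∧ ∀ y < z, ¬ T1 a x.unpair.1 y}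

/-- `x ∈ 𝒞` iff `(x)₀ ∈ 𝒜` and `x ∈ ℬ^⊥`. -/
def setC (a : ℕ) : Set ℕ :=
  {x | x.unpair.1 ∈ W a ∧ x ∈ setBperp a}

/-! ### Gödel numbers, theories -/

/-- Gödel number of a term whose variables are the (de Bruijn) bound variables. -/
def termCode {L : FirstOrder.Language.{0, 0}} [∀ n, Encodable (L.Functions n)] {k : ℕ} :
    L.Term (Empty ⊕ Fin k) → ℕ
  | .var (.inl e) => e.elim
  | .var (.inr i) => Nat.pair 0 i
  | .func (l := n) f ts => Nat.pair 1 (Nat.pair n (Nat.pair (Encodable.encode f)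
      (Encodable.encode (List.ofFn fun i => termCode (ts i)))))

/-- Gödel number of a formula whose variables are the (de Bruijn) bound variables. -/
def formulaCode {L : FirstOrder.Language.{0, 0}} [∀ n, Encodable (L.Functions n)]
    [∀ n, Encodable (L.Relations n)] : {k : ℕ} → L.BoundedFormula Empty k → ℕ
  | _, .falsum => Nat.pair 0 0
  | _, .equal t₁ t₂ => Nat.pair 1 (Nat.pair (termCode t₁) (termCode t₂))
  | _, .rel (l := n) R ts => Nat.pair 2 (Nat.pair n (Nat.pair (Encodable.encode R)
      (Encodable.encode (List.ofFn fun i => termCode (ts i)))))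
  | _, .imp φ ψ => Nat.pair 3 (Nat.pair (formulaCode φ) (formulaCode ψ))
  | _, .all φ => Nat.pair 4 (formulaCode φ)

/-- The set of Gödel numbers of the theorems of `U`, that is, of its logical consequences. -/
def theorems {L : FirstOrder.Language.{0, 0}} [∀ n, Encodable (L.Functions n)]
    [∀ n, Encodable (L.Relations n)] (U : L.Theory) : Set ℕ :=
  {m | ∃ φ : L.Sentence, U ⊨ᵇ φ ∧ formulaCode φ = m}

/-- `U` is essentially undecidable: all its consistent extensions in the same language are
undecidable. -/
def EssentiallyUndecidable {L : FirstOrder.Language.{0, 0}} [∀ n, Encodable (L.Functions n)]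
    [∀ n, Encodable (L.Relations n)] (U : L.Theory) : Prop :=
  ∀ V : L.Theory, (∀ φ : L.Sentence, U ⊨ᵇ φ → V ⊨ᵇ φ) → V.IsSatisfiable →
    ¬ IsRecursive (theorems V)

/-- `U` is a Turing-persistent RE theory: it is RE and consistent, and it is Turing reducible to
every consistent RE theory `V` that extends it, where `V` may have a larger finite signature `L'`
(with any numbering of its symbols). -/
def TuringPersistent {L : FirstOrder.Language.{0, 0}} [∀ n, Encodable (L.Functions n)]
    [∀ n, Encodable (L.Relations n)] (U : L.Theory) : Prop :=
  IsRE (theorems U) ∧ U.IsSatisfiable ∧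
    ∀ (L' : FirstOrder.Language.{0, 0}) [Finite L'.Symbols] [∀ n, Encodable (L'.Functions n)]
      [∀ n, Encodable (L'.Relations n)] (ι : L →ᴸ L') (V : L'.Theory), ι.Injective →
      (∀ φ : L.Sentence, U ⊨ᵇ φ → V ⊨ᵇ ι.onSentence φ) →
      IsRE (theorems V) → V.IsSatisfiable →
      SetTuringReducible (theorems U) (theorems V)

/-! ### The theory `J` -/

/-- The relation symbols of the language of `J`: one binary symbol `E`. -/
inductive ERel : ℕ → Type
  | E : ERel 2

/-- The language with one binary relation symbol. -/
def LE : FirstOrder.Language.{0, 0} := ⟨fun _ => Empty, ERel⟩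

instance (n : ℕ) : Encodable (LE.Functions n) := inferInstanceAs (Encodable Empty)

instance (n : ℕ) : Encodable (LE.Relations n) where
  encode _ := 0
  decode _ := if h : n = 2 then some (h ▸ ERel.E) else none
  encodek R := by cases R; rfl

/-- The symbol `E`. -/
def symE : LE.Relations 2 := ERel.E

/-- The atomic formula `E xᵢ xⱼ`. -/
def fE {k : ℕ} (i j : Fin k) : LE.BoundedFormula Empty k :=
  symE.boundedFormula₂ (&i) (&j)

/-- The formula `xᵢ = xⱼ`. -/
def fEq {k : ℕ} (i j : Fin k) : LE.BoundedFormula Empty k :=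
  (&i : LE.Term (Empty ⊕ Fin k)).bdEqual (&j)

/-- Conjunction of a finite list of formulas. -/
def conj {k : ℕ} (l : List (LE.BoundedFormula Empty k)) : LE.BoundedFormula Empty k :=
  l.foldr (· ⊓ ·) ⊤

/-- Existential quantification over the last `n` variables. -/
def exN {k : ℕ} : (n : ℕ) → LE.BoundedFormula Empty (k + n) → LE.BoundedFormula Empty k
  | 0, φ => φ
  | n + 1, φ => exN n (BoundedFormula.ex φ)

/-- The pairs `(i, j)` with `i < j < n`. -/
def ltPairs (n : ℕ) : List (Fin n × Fin n) :=
  (List.finRange n ×ˢ List.finRange n).filter fun p => p.1 < p.2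

/-- "The class of `xᵢ` has at least `n` elements": there are pairwise distinct `y₁, …, yₙ`, each
with `E xᵢ yⱼ`. -/
def classGe {k : ℕ} (i : Fin k) (n : ℕ) : LE.BoundedFormula Empty k :=
  exN n
    (conj ((List.finRange n).map fun j => fE (Fin.castAdd n i) (Fin.natAdd k j)) ⊓
     conj ((ltPairs n).map fun p => ∼(fEq (Fin.natAdd k p.1) (Fin.natAdd k p.2))))

/-- "The class of `xᵢ` has precisely `n` elements." -/
def classEq {k : ℕ} (i : Fin k) (n : ℕ) : LE.BoundedFormula Empty k :=
  classGe i n ⊓ ∼(classGe i (n + 1))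

/-- "There is at most one equivalence class of size precisely `n`." -/
def J2 (n : ℕ) : LE.Sentence :=
  BoundedFormula.all (BoundedFormula.all
    ((classEq (0 : Fin 2) n ⊓ classEq (1 : Fin 2) n) ⟹ fE (0 : Fin 2) (1 : Fin 2)))

/-- "There are at least `n` equivalence classes with at least `n` elements." -/
def J3 (n : ℕ) : LE.Sentence :=
  BoundedFormula.exs (n := n)
    (conj ((List.finRange n).map fun i => classGe i n) ⊓
     conj ((ltPairs n).map fun p => ∼(fE p.1 p.2)))

/-- The theory `J`: `E` is an equivalence relation, together with all `J2 n` and `J3 n`. -/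
def J : LE.Theory :=
  {symE.reflexive, symE.symmetric, symE.transitive} ∪ Set.range J2 ∪ Set.range J3

/-- The sentence `A_n`: there is an equivalence class of size precisely `n + 1`. -/
def sA (n : ℕ) : LE.Sentence :=
  BoundedFormula.ex (classEq (0 : Fin 1) (n + 1))

/-- `sch(a) = J + {A_n : n ∈ ℬ} + {¬A_m : m ∈ 𝒞}`. -/
def sch (a : ℕ) : LE.Theory :=
  J ∪ {φ | ∃ n ∈ setB a, φ = sA n} ∪ {φ | ∃ m ∈ setC a, φ = ∼(sA m)}

end Shoenfield

namespace Shoenfield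

open FirstOrder FirstOrder.Language

/-! The sets ℬ and 𝒞 are disjoint with union {x | (x)₀ ∈ 𝒜}: when (x)₀ enters 𝒜 at stage y, x goes
to 𝒞 if the function with index (x)₁ has halted on x by then, and to ℬ otherwise. The theorem
combines a lower and an upper bound on the degree.

Lower bound (`setTuringReducible_of_separates`). Let Z = 𝒲_i contain ℬ and avoid 𝒞. To decide n ∈ 𝒜,
ask whether x = ⟨n, i⟩ is in Z. If not, then n ∉ 𝒜, because every x with (x)₀ ∈ 𝒜 is in ℬ ⊆ Z or in
𝒞, and x ∈ 𝒞 also forces x ∈ 𝒲_i. If x ∈ Z, let z be its halting stage. Should n be in 𝒜, then x ∈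
ℬ, so n entered 𝒜 before x entered Z, and it suffices to run the enumeration of 𝒜 up to z. For a
consistent RE theory V extending `sch a`, the n for which V proves A_n form such a separator, and it
is many-one reducible to V (`W_reducible_theorems`). This gives persistence and, since decidable
theories are RE, essential undecidability.

Upper bound (`theorems_sch_reducible`). An Ehrenfeucht–Fraïssé argument (`Matched.exists_snoc`)
shows that a sentence with number at most K cannot distinguish models of the axioms up to K that
have the same class sizes below K. So provability in `sch a` amounts to truth in finitely many
finite structures, one for each subset of {0, …, K - 1} that separates ℬ from 𝒞 there
(`models_sch_iff`). A stage by which all elements of 𝒜 below K have appeared determines these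
subsets, and 𝒜 computes such a stage. Replacing it by an arbitrary stage t gives a sound test that
succeeds for some t exactly on the theorems, so the theory is RE. -/

/-! ### Bounded computations -/

/-- The `e`-th partial recursive function halts on `x` within the resource bound `t`. -/
def haltsIn (e t x : ℕ) : Bool :=
  (Nat.Partrec.Code.evaln t (Denumerable.ofNat Nat.Partrec.Code e) x).isSome

theorem haltsIn_mono {e t t' x : ℕ} (h : t ≤ t') (ht : haltsIn e t x) : haltsIn e t' x := by
  simp only [haltsIn, Option.isSome_iff_exists] at ht ⊢
  obtain ⟨v, hv⟩ := ht
  exact ⟨v, Nat.Partrec.Code.evaln_mono h hv⟩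

theorem primrec_haltsIn : Primrec fun p : ℕ × ℕ × ℕ => haltsIn p.1 p.2.1 p.2.2 :=
  Primrec.option_isSome.comp <| Nat.Partrec.Code.primrec_evaln.comp <|
    ((Primrec.fst.comp Primrec.snd).pair
      ((Primrec.ofNat Nat.Partrec.Code).comp Primrec.fst)).pair (Primrec.snd.comp Primrec.snd)

theorem T1_iff {e x y : ℕ} : T1 e x y ↔ haltsIn e y x ∧ ∀ y' < y, ¬ haltsIn e y' x := Iff.rfl

/-- Comparing least halting stages thus becomes a test of the monotone, primitive recursive
predicate `haltsIn`. -/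
theorem exists_T1_le_iff {e x t : ℕ} : (∃ y ≤ t, T1 e x y) ↔ haltsIn e t x := by
  classical
  constructor
  · rintro ⟨y, hy, h⟩
    exact haltsIn_mono hy (T1_iff.1 h).1
  · intro h
    have hex : ∃ y, haltsIn e y x := ⟨t, h⟩
    exact ⟨Nat.find hex, Nat.find_min' hex h, Nat.find_spec hex, fun y' hy' => Nat.find_min hex hy'⟩

theorem mem_W_iff_haltsIn {e x : ℕ} : x ∈ W e ↔ ∃ t, haltsIn e t x := by
  rw [mem_W_iff]
  constructor
  · rintro ⟨y, hy⟩
    exact ⟨y, hy.1⟩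
  · rintro ⟨t, ht⟩
    obtain ⟨y, -, hy⟩ := exists_T1_le_iff.2 ht
    exact ⟨y, hy⟩

theorem T1_unique {e x y y' : ℕ} (h : T1 e x y) (h' : T1 e x y') : y = y' := by
  rw [T1_iff] at h h'
  rcases lt_trichotomy y y' with hlt | rfl | hlt
  · exact (h'.2 y hlt h.1).elim
  · rfl
  · exact (h.2 y' hlt h'.1).elim

theorem mem_setB_iff {a x : ℕ} :
    x ∈ setB a ↔ ∃ y, T1 a x.unpair.1 y ∧ ¬ haltsIn x.unpair.2 y x := by
  simp only [setB, Set.mem_ofPred_eq, ← exists_T1_le_iff, not_exists, not_and]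

/-- Together with `mem_setB_iff`, this puts the whole difference between ℬ and 𝒞 into one bounded
test at the stage y where (x)₀ enters 𝒜. -/
theorem mem_setC_iff {a x : ℕ} :
    x ∈ setC a ↔ ∃ y, T1 a x.unpair.1 y ∧ haltsIn x.unpair.2 y x := by
  simp only [setC, setBperp, Set.mem_ofPred_eq, mem_W_iff, ← exists_T1_le_iff]
  constructor
  · rintro ⟨⟨y, hy⟩, z, hz, hlt⟩
    exact ⟨y, hy, z, not_lt.1 fun h => hlt y h hy, hz⟩
  · rintro ⟨y, hy, z, hle, hz⟩
    exact ⟨⟨y, hy⟩, z, hz, fun y' hy' h => absurd (T1_unique h hy) (by omega)⟩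

theorem disjoint_setB_setC (a : ℕ) : Disjoint (setB a) (setC a) := by
  rw [Set.disjoint_left]
  intro x hB hC
  obtain ⟨y, hy, h⟩ := mem_setB_iff.1 hB
  obtain ⟨y', hy', h'⟩ := mem_setC_iff.1 hC
  obtain rfl := T1_unique hy hy'
  exact h h'

theorem mem_setB_or_mem_setC {a x : ℕ} (h : x.unpair.1 ∈ W a) : x ∈ setB a ∨ x ∈ setC a := by
  obtain ⟨y, hy⟩ := (mem_W_iff _ _).1 h
  rw [mem_setB_iff, mem_setC_iff]
  by_cases hx : haltsIn x.unpair.2 y x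
  · exact .inr ⟨y, hy, hx⟩
  · exact .inl ⟨y, hy, hx⟩

/-- The elements of `setB a` that appear within the bound `t`. -/
def setBIn (a t : ℕ) : Set ℕ :=
  {x | ∃ y < t + 1, T1 a x.unpair.1 y ∧ ¬ haltsIn x.unpair.2 y x}

/-- The elements of `setC a` that appear within the bound `t`. -/
def setCIn (a t : ℕ) : Set ℕ :=
  {x | ∃ y < t + 1, T1 a x.unpair.1 y ∧ haltsIn x.unpair.2 y x}

theorem setBIn_subset (a t : ℕ) : setBIn a t ⊆ setB a :=
  fun _ ⟨y, _, h⟩ => mem_setB_iff.2 ⟨y, h⟩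

theorem setCIn_subset (a t : ℕ) : setCIn a t ⊆ setC a :=
  fun _ ⟨y, _, h⟩ => mem_setC_iff.2 ⟨y, h⟩

theorem mem_setBIn {a t x : ℕ} (ht : x.unpair.1 ∈ W a → haltsIn a t x.unpair.1)
    (hx : x ∈ setB a) : x ∈ setBIn a t := by
  obtain ⟨y, hy, h⟩ := mem_setB_iff.1 hx
  obtain ⟨y', hle, hy'⟩ := exists_T1_le_iff.2 (ht ((mem_W_iff _ _).2 ⟨y, hy⟩))
  obtain rfl := T1_unique hy hy'
  exact ⟨y, by omega, hy, h⟩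

theorem mem_setCIn {a t x : ℕ} (ht : x.unpair.1 ∈ W a → haltsIn a t x.unpair.1)
    (hx : x ∈ setC a) : x ∈ setCIn a t := by
  obtain ⟨y, hy, h⟩ := mem_setC_iff.1 hx
  obtain ⟨y', hle, hy'⟩ := exists_T1_le_iff.2 (ht ((mem_W_iff _ _).2 ⟨y, hy⟩))
  obtain rfl := T1_unique hy hy'
  exact ⟨y, by omega, hy, h⟩

theorem primrecRel_T1 (a : ℕ) : PrimrecRel fun y x => T1 a x y := by
  have h : PrimrecRel fun y x => haltsIn a y x = true :=
    PrimrecPred.primrecRel (Primrec.eq.comp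
      (primrec_haltsIn.comp ((Primrec.const a).pair (Primrec.fst.pair Primrec.snd)))
      (Primrec.const true))
  exact (PrimrecPred.and h (PrimrecRel.forall_lt (PrimrecRel.not h))).of_eq fun p => by rfl

theorem primrecRel_mem_setBIn (a : ℕ) : PrimrecRel fun t x => x ∈ setBIn a t := by
  have h : PrimrecRel fun y x => T1 a x.unpair.1 y ∧ ¬ haltsIn x.unpair.2 y x := by
    refine PrimrecPred.and ?_ (PrimrecPred.not ?_)
    · exact (primrecRel_T1 a).comp Primrec.fst (Primrec.fst.comp (Primrec.unpair.comp Primrec.snd))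
    · exact Primrec.eq.comp (primrec_haltsIn.comp
        ((Primrec.snd.comp (Primrec.unpair.comp Primrec.snd)).pair
          (Primrec.fst.pair Primrec.snd))) (Primrec.const true)
  exact (PrimrecRel.exists_lt h).comp (Primrec.succ.comp Primrec.fst) Primrec.snd

theorem primrecRel_mem_setCIn (a : ℕ) : PrimrecRel fun t x => x ∈ setCIn a t := by
  have h : PrimrecRel fun y x => T1 a x.unpair.1 y ∧ haltsIn x.unpair.2 y x := by
    refine PrimrecPred.and ?_ ?_
    · exact (primrecRel_T1 a).comp Primrec.fst (Primrec.fst.comp (Primrec.unpair.comp Primrec.snd))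
    · exact Primrec.eq.comp (primrec_haltsIn.comp
        ((Primrec.snd.comp (Primrec.unpair.comp Primrec.snd)).pair
          (Primrec.fst.pair Primrec.snd))) (Primrec.const true)
  exact (PrimrecRel.exists_lt h).comp (Primrec.succ.comp Primrec.fst) Primrec.snd

/-! ### Turing reducibility -/

open Classical in
/-- A function computed with one query to the oracle `T`. -/
theorem recursiveIn_of_query {T : Set ℕ} {f : ℕ → ℕ} {g : ℕ → ℕ} {F : ℕ × ℕ →. ℕ}
    (hg : Computable g) (hF : Partrec F)
    (h : ∀ n, f n ∈ F (n, if g n ∈ T then 1 else 0)) :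
    Nat.RecursiveIn {chi T} fun n => Part.some (f n) := by
  have h1 : Nat.RecursiveIn {chi T} (chi T) := .oracle _ rfl
  have h2 : Nat.RecursiveIn {chi T} fun n => Part.some (g n) :=
    (Partrec.nat_iff.1 hg.partrec).recursiveIn
  have h3 : Nat.RecursiveIn {chi T} fun n => Part.some n :=
    (Partrec.nat_iff.1 Computable.id.partrec).recursiveIn
  have h4 : Nat.RecursiveIn {chi T} fun n => F n.unpair :=
    (Partrec.nat_iff.1 (hF.comp Computable.unpair)).recursiveIn
  refine (Nat.RecursiveIn.comp h4 (Nat.RecursiveIn.pair h3 (Nat.RecursiveIn.comp h1 h2))).of_eq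
    fun n => ?_
  rw [eq_comm, ← Part.eq_some_iff.2 (h n)]
  have h5 : (Part.some (g n) >>= chi T) = Part.some (if g n ∈ T then 1 else 0) :=
    (Part.bind_some _ _).trans (by simp only [chi])
  simp only [h5]
  simp [Seq.seq]

theorem chi_eq_some (S : Set ℕ) (n : ℕ) [Decidable (n ∈ S)] :
    chi S n = Part.some (if n ∈ S then 1 else 0) := by
  simp only [chi]; congr

/-- `F` receives the input and the oracle's answer. It may diverge on a wrong answer, so a positive
answer can license an unbounded search. -/
theorem setTuringReducible_of_query {S T : Set ℕ} {g : ℕ → ℕ} {F : ℕ × ℕ →. ℕ}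
    (hg : Computable g) (hF : Partrec F)
    (h1 : ∀ n, g n ∈ T → (n ∈ S → 1 ∈ F (n, 1)) ∧ (n ∉ S → 0 ∈ F (n, 1)))
    (h0 : ∀ n, g n ∉ T → (n ∈ S → 1 ∈ F (n, 0)) ∧ (n ∉ S → 0 ∈ F (n, 0))) :
    SetTuringReducible S T := by
  classical
  refine RecursiveIn.iff_nat.2 ((recursiveIn_of_query (T := T) (f := fun n => if n ∈ S then 1 else 0)
    hg hF fun n => ?_).of_eq fun n => (chi_eq_some S n).symm)
  by_cases hT : g n ∈ T <;> by_cases hS : n ∈ S <;> simp [hT, hS, h1, h0]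

theorem SetTuringReducible.trans {S T U : Set ℕ} (h : SetTuringReducible S T)
    (h' : SetTuringReducible T U) : SetTuringReducible S U :=
  TuringReducible.trans h h'

theorem degree_eq_iff {S T : Set ℕ} :
    degree S = degree T ↔ SetTuringReducible S T ∧ SetTuringReducible T S :=
  Quotient.eq

/-- Many-one reducible sets are Turing reducible. -/
theorem setTuringReducible_preimage {T : Set ℕ} {g : ℕ → ℕ} (hg : Computable g) :
    SetTuringReducible {n | g n ∈ T} T :=
  setTuringReducible_of_query (F := fun p => Part.some p.2) hg Computable.snd.partrec
    (fun n h => by simp [h]) (fun n h => by simp [h])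

theorem isRecursive_iff_partrec_chi {S : Set ℕ} : IsRecursive S ↔ Partrec (chi S) := by
  classical
  constructor
  · intro h
    have : Computable fun n => if n ∈ S then 1 else 0 :=
      (Computable.cond h.decide (Computable.const 1) (Computable.const 0)).of_eq fun n => by
        by_cases hn : n ∈ S <;> simp [hn]
    exact this.partrec.of_eq fun n => (chi_eq_some S n).symm
  · intro h
    have h' : Computable fun n => if n ∈ S then 1 else 0 :=
      h.of_eq_tot (g := fun n => if n ∈ S then 1 else 0) fun n => by
        rw [chi_eq_some S n]; exact Part.mem_some _
    have : Computable fun n => decide (n ∈ S) :=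
      Computable.of_eq (Primrec.eq.decide.to_comp.comp h' (Computable.const 1)) fun n => by
        by_cases hn : n ∈ S <;> simp [hn]
    exact this.computablePred

theorem IsRecursive.of_setTuringReducible {S T : Set ℕ} (hT : IsRecursive T)
    (h : SetTuringReducible S T) : IsRecursive S := by
  rw [isRecursive_iff_partrec_chi] at hT ⊢
  exact RecursiveIn.partrec_of_oracle (by simpa using hT) h

theorem IsRecursive.setTuringReducible {S : Set ℕ} (hS : IsRecursive S) (T : Set ℕ) :
    SetTuringReducible S T :=
  (isRecursive_iff_partrec_chi.1 hS).turingReducible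

theorem isRecursive_empty : IsRecursive ∅ :=
  ⟨fun _ => isFalse id, by simpa using Computable.const false⟩

theorem IsRE.exists_index {S : Set ℕ} (h : IsRE S) : ∃ e, W e = S := by
  have h' : Partrec fun n => (Part.assert (n ∈ S) fun _ => Part.some ()).map fun _ => 0 :=
    Partrec.map h (Computable.const 0).to₂
  obtain ⟨c, hc⟩ := Nat.Partrec.Code.exists_code.1 (Partrec.nat_iff.1 h')
  refine ⟨Encodable.encode c, ?_⟩
  ext x
  simp only [W, hc, Denumerable.ofNat_encode, Set.mem_ofPred_eq]
  exact ⟨fun h => h.1, fun h => ⟨h, trivial⟩⟩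

theorem isRE_of_exists {S : Set ℕ} {D : ℕ → ℕ → Prop} (hD : PrimrecRel D)
    (h : ∀ n, n ∈ S ↔ ∃ t, D n t) : IsRE S := by
  classical
  have h1 : Partrec fun n => Nat.rfind fun t => Part.some (decide (D n t)) :=
    Partrec.rfind hD.decide.to_comp.partrec
  refine h1.dom_re.of_eq fun n => Nat.rfind_dom.trans ?_
  rw [h n]
  simp

theorem isRE_preimage {S : Set ℕ} {g : ℕ → ℕ} (hg : Computable g) (h : IsRE S) :
    IsRE {n | g n ∈ S} :=
  Partrec.comp h hg

/-- Shoenfield's lemma: every RE set that separates `setB a` from `setC a` computes `W a`. -/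
theorem setTuringReducible_of_separates {a : ℕ} {Z : Set ℕ} (hZ : IsRE Z) (hB : setB a ⊆ Z)
    (hC : Disjoint (setC a) Z) : SetTuringReducible (W a) Z := by
  classical
  -- The query for n will be ⟨n, i⟩, whose second coordinate is an index of the separator itself:
  -- the race defining ℬ and 𝒞 is then run against `Z`.
  obtain ⟨i, rfl⟩ := hZ.exists_index
  -- On answer 0 the search stops at once with output 0. On answer 1 it finds the stage z at which
  -- ⟨n, i⟩ enters `Z`, and tests whether n has entered 𝒜 by z.
  let F : ℕ × ℕ →. ℕ := fun p =>
    (Nat.rfind fun z => Part.some (decide (p.2 = 0) || haltsIn i z (Nat.pair p.1 i))).map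
      fun z => cond (decide (p.2 = 0)) 0 (cond (haltsIn a z p.1) 1 0)
  have hF : Partrec F := by
    refine Partrec.map (Partrec.rfind ?_) ?_
    · refine Computable₂.partrec₂ (Primrec₂.to_comp ?_)
      refine Primrec.or.comp (Primrec.eq.decide.comp (Primrec.snd.comp Primrec.fst) (Primrec.const 0)) ?_
      exact primrec_haltsIn.comp ((Primrec.const i).pair (Primrec.snd.pair
        (Primrec₂.natPair.comp (Primrec.fst.comp Primrec.fst) (Primrec.const i))))
    · refine Primrec₂.to_comp ?_
      refine Primrec.cond (Primrec.eq.decide.comp (Primrec.snd.comp Primrec.fst) (Primrec.const 0))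
        (Primrec.const 0) (Primrec.cond ?_ (Primrec.const 1) (Primrec.const 0))
      exact primrec_haltsIn.comp ((Primrec.const a).pair (Primrec.snd.pair
        (Primrec.fst.comp Primrec.fst)))
  refine setTuringReducible_of_query (g := fun n => Nat.pair n i) (F := F)
    (Primrec₂.natPair.comp Primrec.id (Primrec.const i)).to_comp hF ?_ ?_
  · intro n hn
    obtain ⟨z, hz, hzmin⟩ := (mem_W_iff _ _).1 hn
    have hmem : z ∈ Nat.rfind fun z => Part.some
        (decide ((n, 1).2 = 0) || haltsIn i z (Nat.pair n i)) := by
      refine Nat.mem_rfind.2 ⟨by simpa using! hz, fun {m} hm => ?_⟩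
      have := hzmin m hm
      simpa [haltsIn] using this
    have hval : (cond (haltsIn a z n) 1 0) ∈ F (n, 1) :=
      Part.mem_map_iff _ |>.2 ⟨z, hmem, by simp⟩
    constructor
    · intro hnA
      have hx : Nat.pair n i ∈ setB a :=
        (mem_setB_or_mem_setC (x := Nat.pair n i) (by simpa using hnA)).resolve_right
          fun h => Set.disjoint_left.1 hC h hn
      obtain ⟨y, hy, hyi⟩ := mem_setB_iff.1 hx
      simp only [Nat.unpair_pair] at hy hyi
      -- Membership in ℬ says that index `i` has not halted by stage y, while it has by stage z.
      have hlt : y < z := not_le.1 fun h => hyi (haltsIn_mono h hz)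
      have : haltsIn a z n := haltsIn_mono hlt.le hy.1
      simpa [this] using hval
    · intro hnA
      have : haltsIn a z n = false := by
        by_contra h
        exact hnA (mem_W_iff_haltsIn.2 ⟨z, by simpa using h⟩)
      simpa [this] using hval
  · intro n hn
    have hnA : n ∉ W a := fun hnA => by
      rcases mem_setB_or_mem_setC (x := Nat.pair n i) (by simpa using hnA) with h | h
      · exact hn (hB h)
      · obtain ⟨y, -, hy⟩ := mem_setC_iff.1 h
        exact hn (mem_W_iff_haltsIn.2 ⟨y, by simpa using hy⟩)
    refine ⟨fun h => (hnA h).elim, fun _ => Part.mem_map_iff _ |>.2 ⟨0, ?_, by simp⟩⟩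
    exact Nat.mem_rfind.2 ⟨by simp, by simp⟩

/-! ### A modulus of `W a` that is recursive in `W a` -/

open Classical in
/-- The least bound for the computation of the `a`-th function on `n`, or `0` if it diverges. -/
noncomputable def haltingTime (a n : ℕ) : ℕ :=
  if h : ∃ t, haltsIn a t n then Nat.find h else 0

/-- A bound that suffices for all halting computations on inputs below `n`. -/
noncomputable def modulus (a n : ℕ) : ℕ := ∑ i ∈ Finset.range n, haltingTime a i

theorem haltsIn_modulus {a n i : ℕ} (hi : i < n) (h : i ∈ W a) : haltsIn a (modulus a n) i := by
  classical
  have hex := mem_W_iff_haltsIn.1 h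
  have h1 : haltsIn a (haltingTime a i) i := by
    rw [haltingTime, dif_pos hex]
    exact Nat.find_spec hex
  exact haltsIn_mono (Finset.single_le_sum (f := haltingTime a) (fun _ _ => Nat.zero_le _)
    (Finset.mem_range.2 hi)) h1

/-- Asking the oracle first whether n ∈ `W a` makes the search for a halting bound safe. -/
theorem recursiveIn_haltingTime (a : ℕ) :
    Nat.RecursiveIn {chi (W a)} fun n => Part.some (haltingTime a n) := by
  classical
  refine recursiveIn_of_query (g := id) (F := fun p =>
    Nat.rfind fun t => Part.some (decide (p.2 = 0) || haltsIn a t p.1)) Computable.id ?_ ?_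
  · refine Partrec.rfind (Computable₂.partrec₂ (Primrec₂.to_comp ?_))
    refine Primrec.or.comp (Primrec.eq.decide.comp (Primrec.snd.comp Primrec.fst) (Primrec.const 0)) ?_
    exact primrec_haltsIn.comp ((Primrec.const a).pair (Primrec.snd.pair
        (Primrec.fst.comp Primrec.fst)))
  · intro n
    by_cases hn : n ∈ W a
    · have hex := mem_W_iff_haltsIn.1 hn
      simp only [id, hn, if_true, haltingTime, dif_pos hex]
      refine Nat.mem_rfind.2 ⟨by simpa using Nat.find_spec hex, fun {m} hm => ?_⟩
      simpa using Nat.find_min hex hm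
    · have hex : ¬ ∃ t, haltsIn a t n := fun h => hn (mem_W_iff_haltsIn.2 h)
      simp only [id, hn, if_false, haltingTime, dif_neg hex]
      exact Nat.mem_rfind.2 ⟨by simp, by simp⟩

theorem recursiveIn_modulus (a : ℕ) :
    Nat.RecursiveIn {chi (W a)} fun n => Part.some (modulus a n) := by
  -- `Nat.RecursiveIn.prec` carries a parameter; the 0 is a dummy for it. In the step function the
  -- counter and the previous value are the two halves of the second coordinate.
  have h0 : Nat.RecursiveIn {chi (W a)} fun n => Part.some (Nat.pair 0 n) :=
    (Partrec.nat_iff.1 (Primrec₂.natPair.comp (Primrec.const 0)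
      Primrec.id).to_comp.partrec).recursiveIn
  have h1 : Nat.RecursiveIn {chi (W a)} fun p => Part.some p.unpair.2.unpair.1 :=
    (Partrec.nat_iff.1 (Primrec.fst.comp (Primrec.unpair.comp (Primrec.snd.comp
      Primrec.unpair))).to_comp.partrec).recursiveIn
  have h2 : Nat.RecursiveIn {chi (W a)} fun p => Part.some p.unpair.2.unpair.2 :=
    (Partrec.nat_iff.1 (Primrec.snd.comp (Primrec.unpair.comp (Primrec.snd.comp
      Primrec.unpair))).to_comp.partrec).recursiveIn
  have h3 : Nat.RecursiveIn {chi (W a)} fun p => Part.some (p.unpair.1 + p.unpair.2) :=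
    (Partrec.nat_iff.1 (Primrec.nat_add.comp (Primrec.fst.comp Primrec.unpair)
      (Primrec.snd.comp Primrec.unpair)).to_comp.partrec).recursiveIn
  have hz : Nat.RecursiveIn {chi (W a)} fun _ => Part.some 0 := .zero
  refine (Nat.RecursiveIn.comp (Nat.RecursiveIn.prec hz (Nat.RecursiveIn.comp h3
    (Nat.RecursiveIn.pair h2 ((recursiveIn_haltingTime a).comp h1)))) h0).of_eq fun n => ?_
  simp only [Part.bind_eq_bind, Part.bind_some, Nat.unpair_pair]
  induction n with
  | zero => simp [modulus]
  | succ n ih =>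
    simp only [ih]
    simp [modulus, Finset.sum_range_succ, Seq.seq]

theorem setTuringReducible_of_modulus {a : ℕ} {S : Set ℕ} {D : ℕ → ℕ → Prop} {g : ℕ → ℕ}
    (hD : PrimrecRel D) (hg : Computable g) (h : ∀ n, n ∈ S ↔ D n (modulus a (g n))) :
    SetTuringReducible S (W a) := by
  classical
  have hF : Computable fun p : ℕ => if D p.unpair.1 p.unpair.2 then 1 else 0 :=
    ((Primrec.ite (hD.comp (Primrec.fst.comp Primrec.unpair)
      (Primrec.snd.comp Primrec.unpair)) (Primrec.const 1) (Primrec.const 0))).to_comp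
  have h1 : Nat.RecursiveIn {chi (W a)} fun p => Part.some (if D p.unpair.1 p.unpair.2 then 1 else 0) :=
    (Partrec.nat_iff.1 hF.partrec).recursiveIn
  have h2 : Nat.RecursiveIn {chi (W a)} fun n => Part.some (g n) :=
    (Partrec.nat_iff.1 hg.partrec).recursiveIn
  have h3 : Nat.RecursiveIn {chi (W a)} fun n => Part.some n :=
    (Partrec.nat_iff.1 Computable.id.partrec).recursiveIn
  refine RecursiveIn.iff_nat.2 ((h1.comp (h3.pair ((recursiveIn_modulus a).comp h2))).of_eq
    fun n => ?_)
  rw [chi_eq_some S n]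
  simp [h, Seq.seq]

/-! ### Gödel numbers -/

section Codes

variable {L : FirstOrder.Language.{0, 0}} [∀ n, Encodable (L.Functions n)]

theorem termCode_injective {k : ℕ} :
    Function.Injective (termCode : L.Term (Empty ⊕ Fin k) → ℕ) := by
  intro t
  induction t with
  | var x =>
    rcases x with e | i
    · exact e.elim
    · intro t' h
      rcases t' with (e | j) | ⟨g, us⟩
      · exact e.elim
      · simpa [termCode, Fin.ext_iff] using h
      · simp [termCode] at h
  | func f ts ih =>
    intro t' h
    rcases t' with (e | j) | ⟨g, us⟩
    · exact e.elim
    · simp [termCode] at h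
    · simp only [termCode, Nat.pair_eq_pair, true_and] at h
      obtain ⟨rfl, hf, hts⟩ := h
      obtain rfl := Encodable.encode_injective hf
      have := List.ofFn_injective (Encodable.encode_injective hts)
      congr 1
      funext i
      exact ih i (congrFun this i)

variable [∀ n, Encodable (L.Relations n)]

/-- Injectivity is what makes membership of a sentence's number in `theorems U` equivalent to its
being a consequence of `U`. -/
theorem formulaCode_injective {k : ℕ} :
    Function.Injective (formulaCode : L.BoundedFormula Empty k → ℕ) := by
  intro φ
  induction φ with
  | falsum =>
    intro ψ h
    cases ψ <;> simp [formulaCode] at h ⊢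
  | equal t₁ t₂ =>
    intro ψ h
    cases ψ <;> simp [formulaCode] at h ⊢
    exact ⟨termCode_injective h.1, termCode_injective h.2⟩
  | rel R ts =>
    intro ψ h
    cases ψ with
    | rel R' ts' =>
      simp only [formulaCode, Nat.pair_eq_pair, true_and] at h
      obtain ⟨rfl, hR, hts⟩ := h
      obtain rfl := Encodable.encode_injective hR
      have := List.ofFn_injective (Encodable.encode_injective hts)
      congr 1
      funext i
      exact termCode_injective (congrFun this i)
    | _ => simp [formulaCode] at h
  | imp φ₁ φ₂ ih₁ ih₂ =>
    intro ψ h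
    cases ψ <;> simp [formulaCode] at h ⊢
    exact ⟨ih₁ h.1, ih₂ h.2⟩
  | all φ ih =>
    intro ψ h
    cases ψ <;> simp [formulaCode] at h ⊢
    exact ih h

theorem formulaCode_mem_theorems {U : L.Theory} {φ : L.Sentence} :
    formulaCode φ ∈ theorems U ↔ U ⊨ᵇ φ :=
  ⟨fun ⟨_, h, e⟩ => formulaCode_injective e ▸ h, fun h => ⟨φ, h, rfl⟩⟩

end Codes

/-! ### The Gödel numbers of the sentences `A_n` -/

def impCode (a b : ℕ) : ℕ := Nat.pair 3 (Nat.pair a b)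

/-- Negation is implication of falsum, whose number is `Nat.pair 0 0 = 0`. -/
def notCode (a : ℕ) : ℕ := impCode a 0

def andCode (a b : ℕ) : ℕ := notCode (impCode a (notCode b))

def exCode (a : ℕ) : ℕ := notCode (Nat.pair 4 (notCode a))

def conjCode (l : List ℕ) : ℕ := l.foldr andCode (notCode 0)

def eqCode (i j : ℕ) : ℕ := Nat.pair 1 (Nat.pair (Nat.pair 0 i) (Nat.pair 0 j))

/-- The Gödel number of `R xᵢ xⱼ`, where `R` has the number `e`. -/
def relCode (e i j : ℕ) : ℕ :=
  Nat.pair 2 (Nat.pair 2 (Nat.pair e (Encodable.encode [Nat.pair 0 i, Nat.pair 0 j])))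

def ltPairsCode (n : ℕ) : List (ℕ × ℕ) :=
  (List.range n ×ˢ List.range n).filter fun p => p.1 < p.2

/-- The Gödel number of "the class of `x₀` has at least `n` elements" as a formula in `x₀`. -/
def classGeCode (e n : ℕ) : ℕ :=
  exCode^[n] (andCode (conjCode ((List.range n).map fun j => relCode e 0 (1 + j)))
    (conjCode ((ltPairsCode n).map fun p => notCode (eqCode (1 + p.1) (1 + p.2)))))

/-- The Gödel number of `A_n`. -/
def sACode (e n : ℕ) : ℕ :=
  exCode (andCode (classGeCode e (n + 1)) (notCode (classGeCode e (n + 2))))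

section Translate

variable {L' : FirstOrder.Language.{0, 0}} [∀ n, Encodable (L'.Functions n)]
  [∀ n, Encodable (L'.Relations n)] (ι : LE →ᴸ L')

/-- The Gödel number of the translation of a formula. -/
def transCode {k : ℕ} (φ : LE.BoundedFormula Empty k) : ℕ :=
  formulaCode (ι.onBoundedFormula φ)

theorem transCode_not {k : ℕ} (φ : LE.BoundedFormula Empty k) :
    transCode ι (∼φ) = notCode (transCode ι φ) := rfl

theorem transCode_inf {k : ℕ} (φ ψ : LE.BoundedFormula Empty k) :
    transCode ι (φ ⊓ ψ) = andCode (transCode ι φ) (transCode ι ψ) := rfl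

theorem transCode_ex {k : ℕ} (φ : LE.BoundedFormula Empty (k + 1)) :
    transCode ι φ.ex = exCode (transCode ι φ) := rfl

theorem transCode_exN {k n : ℕ} (φ : LE.BoundedFormula Empty (k + n)) :
    transCode ι (exN n φ) = exCode^[n] (transCode ι φ) := by
  induction n with
  | zero => rfl
  | succ n ih => rw [exN, ih, transCode_ex, Function.iterate_succ_apply]

theorem transCode_conj {k : ℕ} (l : List (LE.BoundedFormula Empty k)) :
    transCode ι (conj l) = conjCode (l.map (transCode ι)) := by
  induction l with
  | nil => rfl
  | cons φ l ih =>
    change andCode (transCode ι φ) (transCode ι (conj l)) = _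
    rw [ih]; rfl

theorem transCode_fEq {k : ℕ} (i j : Fin k) : transCode ι (fEq i j) = eqCode i j := by
  simp [transCode, fEq, Term.bdEqual, LHom.onBoundedFormula, formulaCode, LHom.onTerm, termCode, eqCode]

theorem transCode_fE {k : ℕ} (i j : Fin k) :
    transCode ι (fE i j) = relCode (Encodable.encode (ι.onRelation symE)) i j := by
  simp [transCode, fE, Relations.boundedFormula₂, Relations.boundedFormula, LHom.onBoundedFormula,
    formulaCode, LHom.onTerm, termCode, relCode, List.ofFn_succ]

theorem map_ltPairs (n : ℕ) :
    (ltPairs n).map (fun p => ((p.1 : ℕ), (p.2 : ℕ))) = ltPairsCode n := by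
  rw [ltPairs, ltPairsCode, ← List.map_coe_finRange_eq_range]
  have : ((List.finRange n).map Fin.val ×ˢ (List.finRange n).map Fin.val) =
      (List.finRange n ×ˢ List.finRange n).map (fun p => ((p.1 : ℕ), (p.2 : ℕ))) := by
    generalize List.finRange n = l'
    simp only [SProd.sprod, List.product, List.map_flatMap, List.flatMap_map, List.map_map]
    rfl
  rw [this, List.filter_map]
  rfl

theorem transCode_classGe (n : ℕ) :
    transCode ι (classGe (0 : Fin 1) n) =
      classGeCode (Encodable.encode (ι.onRelation symE)) n := by
  rw [classGe, transCode_exN, transCode_inf, transCode_conj, transCode_conj, classGeCode,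
    ← map_ltPairs, ← List.map_coe_finRange_eq_range]
  simp only [List.map_map, Function.comp_def, transCode_fE, transCode_not, transCode_fEq]
  rfl

/-- The numbering of `L'` is arbitrary, but A_n contains only one nonlogical symbol. The number of
its translation therefore depends only on n and the constant `e` given to that symbol, and is
primitive recursive in n. -/
theorem formulaCode_onSentence_sA (n : ℕ) :
    formulaCode (ι.onSentence (sA n)) = sACode (Encodable.encode (ι.onRelation symE)) n := by
  change transCode ι (sA n) = _
  rw [sA, transCode_ex, classEq, transCode_inf, transCode_not, transCode_classGe,
    transCode_classGe]
  rfl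

end Translate

/-! ### Primitive recursiveness of the number of A_n -/

theorem primrec_impCode : Primrec₂ impCode :=
  Primrec₂.natPair.comp (Primrec.const 3) (Primrec₂.natPair.comp Primrec.fst Primrec.snd)

theorem primrec_notCode : Primrec notCode :=
  primrec_impCode.comp Primrec.id (Primrec.const 0)

theorem primrec_andCode : Primrec₂ andCode :=
  primrec_notCode.comp (primrec_impCode.comp Primrec.fst (primrec_notCode.comp Primrec.snd))

theorem primrec_exCode : Primrec exCode :=
  primrec_notCode.comp (Primrec₂.natPair.comp (Primrec.const 4) primrec_notCode)

theorem primrec_conjCode : Primrec conjCode :=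
  Primrec.list_foldr Primrec.id (Primrec.const _)
    (primrec_andCode.comp (Primrec.fst.comp Primrec.snd) (Primrec.snd.comp Primrec.snd)).to₂

theorem primrec_eqCode : Primrec₂ eqCode :=
  Primrec₂.natPair.comp (Primrec.const 1) (Primrec₂.natPair.comp
    (Primrec₂.natPair.comp (Primrec.const 0) Primrec.fst)
    (Primrec₂.natPair.comp (Primrec.const 0) Primrec.snd))

theorem primrec_relCode (e : ℕ) : Primrec₂ (relCode e) :=
  Primrec₂.natPair.comp (Primrec.const 2) <| Primrec₂.natPair.comp (Primrec.const 2) <|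
    Primrec₂.natPair.comp (Primrec.const e) <| Primrec.encode.comp <|
      Primrec.list_cons.comp (Primrec₂.natPair.comp (Primrec.const 0) Primrec.fst) <|
        Primrec.list_cons.comp (Primrec₂.natPair.comp (Primrec.const 0) Primrec.snd)
          (Primrec.const [])

theorem primrec_ltPairsCode : Primrec ltPairsCode := by
  have h : Primrec fun n : ℕ => List.range n ×ˢ List.range n := by
    refine Primrec.list_flatMap Primrec.list_range ?_
    exact Primrec.list_map (Primrec.list_range.comp Primrec.fst)
      (Primrec.pair (Primrec.snd.comp Primrec.fst) Primrec.snd).to₂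
  exact (Primrec.listFilter (Primrec.nat_lt.comp Primrec.fst Primrec.snd)).comp h

theorem primrec_classGeCode (e : ℕ) : Primrec (classGeCode e) := by
  refine Primrec.nat_iterate Primrec.id (primrec_andCode.comp ?_ ?_)
    (primrec_exCode.comp Primrec.snd).to₂
  · exact primrec_conjCode.comp (Primrec.list_map Primrec.list_range
      ((primrec_relCode e).comp (Primrec.const 0)
        (Primrec.nat_add.comp (Primrec.const 1) Primrec.snd)).to₂)
  · exact primrec_conjCode.comp (Primrec.list_map primrec_ltPairsCode
      (primrec_notCode.comp (primrec_eqCode.comp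
        (Primrec.nat_add.comp (Primrec.const 1) (Primrec.fst.comp Primrec.snd))
        (Primrec.nat_add.comp (Primrec.const 1) (Primrec.snd.comp Primrec.snd)))).to₂)

theorem primrec_sACode (e : ℕ) : Primrec (sACode e) :=
  primrec_exCode.comp <| primrec_andCode.comp
    ((primrec_classGeCode e).comp (Primrec.nat_add.comp Primrec.id (Primrec.const 1)))
    (primrec_notCode.comp
      ((primrec_classGeCode e).comp (Primrec.nat_add.comp Primrec.id (Primrec.const 2))))

/-! ### Evaluation of formulas in finite structures -/

/-- The structure on a set of numbers in which two numbers are equivalent if they have the same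
first coordinate. -/
instance fstStructure (D : Set ℕ) : LE.Structure D where
  funMap f := f.elim
  RelMap {_} R := match R with
    | ERel.E => fun v => (v 0 : ℕ).unpair.1 = (v 1 : ℕ).unpair.1

/-- The calls of `evalCode` that the value at the formula code `b.1` and the environment `b.2`
depends on, in the structure with universe `els`. -/
def evalCalls (els : List ℕ) (b : ℕ × List ℕ) : List (ℕ × List ℕ) :=
  if b.1.unpair.1 = 3 then
    [(b.1.unpair.2.unpair.1, b.2), (b.1.unpair.2.unpair.2, b.2)]
  else if b.1.unpair.1 = 4 then els.map fun x => (b.1.unpair.2, b.2 ++ [x])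
  else []

/-- The value of the variable with code `t`. -/
def evalVar (env : List ℕ) (t : ℕ) : Option ℕ :=
  if t.unpair.1 = 0 then env[t.unpair.2]? else none

def evalEqual (env : List ℕ) (p : ℕ) : Option Bool :=
  (evalVar env p.unpair.1).bind fun x => (evalVar env p.unpair.2).map fun y => decide (x = y)

/-- The codes of the two terms in the code `q` of a list of two terms. -/
def argCodes (q : ℕ) : ℕ × ℕ := (q.pred.unpair.1, q.pred.unpair.2.pred.unpair.1)

/-- Here 2 is the arity and 0 the number of `E`. Re-encoding the extracted arguments and comparing
with `p` rejects numbers that are not codes of atoms. -/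
def evalRel (env : List ℕ) (p : ℕ) : Option Bool :=
  if p = Nat.pair 2 (Nat.pair 0 (Encodable.encode
      [(argCodes p.unpair.2.unpair.2).1, (argCodes p.unpair.2.unpair.2).2])) then
    (evalVar env (argCodes p.unpair.2.unpair.2).1).bind fun x =>
      (evalVar env (argCodes p.unpair.2.unpair.2).2).map fun y =>
        decide (x.unpair.1 = y.unpair.1)
  else none

def evalImp : Option Bool × Option Bool → Option Bool
  | (some x, some y) => some (!x || y)
  | _ => none

def evalAll (l : List (Option Bool)) : Option Bool :=
  if ∃ r ∈ l, r = none then none else some (decide (∀ r ∈ l, r = some true))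

/-- The values of the recursive calls arrive as the list `l`, the form of recursion that
`Primrec.nat_omega_rec` handles. -/
def evalStep (b : ℕ × List ℕ) (l : List (Option Bool)) : Option Bool :=
  if b.1.unpair.1 = 0 then (if b.1.unpair.2 = 0 then some false else none)
  else if b.1.unpair.1 = 1 then evalEqual b.2 b.1.unpair.2
  else if b.1.unpair.1 = 2 then evalRel b.2 b.1.unpair.2
  else if b.1.unpair.1 = 3 then evalImp (l.getD 0 none, l.getD 1 none)
  else if b.1.unpair.1 = 4 then evalAll l
  else none

theorem lt_of_mem_evalCalls {els : List ℕ} {b b' : ℕ × List ℕ} (h : b' ∈ evalCalls els b) :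
    b'.1 < b.1 := by
  have h1 := Nat.add_le_pair b.1.unpair.1 b.1.unpair.2
  have h2 := Nat.add_le_pair b.1.unpair.2.unpair.1 b.1.unpair.2.unpair.2
  rw [Nat.pair_unpair] at h1 h2
  unfold evalCalls at h
  split_ifs at h with h3 h4
  · rcases (by simpa using h) with rfl | rfl <;> dsimp only <;> omega
  · obtain ⟨x, -, rfl⟩ := List.mem_map.1 h
    dsimp only
    omega
  · simp at h

/-- The truth value of the formula with code `b.1` under the assignment `b.2` in the structure
with universe `els`; `none` if `b.1` is not the code of a formula. -/
def evalCode (els : List ℕ) (b : ℕ × List ℕ) : Option Bool :=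
  evalStep b ((evalCalls els b).attach.map fun b' => evalCode els b'.1)
termination_by b.1
decreasing_by exact lt_of_mem_evalCalls b'.2

theorem evalCode_eq (els : List ℕ) (b : ℕ × List ℕ) :
    evalCode els b = evalStep b ((evalCalls els b).map (evalCode els)) := by
  rw [evalCode]
  simp

/-! ### Primitive recursiveness of the evaluation -/

theorem primrec_evalVar : Primrec₂ evalVar :=
  Primrec.ite (Primrec.eq.comp (Primrec.fst.comp (Primrec.unpair.comp Primrec.snd))
    (Primrec.const 0)) (Primrec.list_getElem?.comp Primrec.fst
      (Primrec.snd.comp (Primrec.unpair.comp Primrec.snd))) (Primrec.const none)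

theorem primrec_evalEqual : Primrec₂ evalEqual := by
  refine Primrec.option_bind (primrec_evalVar.comp Primrec.fst
    (Primrec.fst.comp (Primrec.unpair.comp Primrec.snd))) ?_
  refine Primrec.option_map (primrec_evalVar.comp (Primrec.fst.comp Primrec.fst)
    (Primrec.snd.comp (Primrec.unpair.comp (Primrec.snd.comp Primrec.fst)))) ?_
  exact Primrec.eq.decide.comp (Primrec.snd.comp Primrec.fst) Primrec.snd

theorem primrec_argCodes : Primrec argCodes := by
  have h : Primrec fun q : ℕ => q.pred.unpair := Primrec.unpair.comp Primrec.pred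
  exact (Primrec.fst.comp h).pair
    (Primrec.fst.comp (Primrec.unpair.comp (Primrec.pred.comp (Primrec.snd.comp h))))

theorem primrec_evalRel : Primrec₂ evalRel := by
  have h : Primrec fun b : List ℕ × ℕ => argCodes b.2.unpair.2.unpair.2 :=
    primrec_argCodes.comp (Primrec.snd.comp (Primrec.unpair.comp (Primrec.snd.comp
      (Primrec.unpair.comp Primrec.snd))))
  refine Primrec.ite (Primrec.eq.comp Primrec.snd ?_) ?_ (Primrec.const none)
  · refine Primrec₂.natPair.comp (Primrec.const 2) (Primrec₂.natPair.comp (Primrec.const 0)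
      (Primrec.encode.comp ?_))
    exact Primrec.list_cons.comp (Primrec.fst.comp h)
      (Primrec.list_cons.comp (Primrec.snd.comp h) (Primrec.const []))
  · refine Primrec.option_bind (primrec_evalVar.comp Primrec.fst (Primrec.fst.comp h)) ?_
    refine Primrec.option_map (primrec_evalVar.comp (Primrec.fst.comp Primrec.fst)
      (Primrec.snd.comp (h.comp Primrec.fst))) ?_
    exact Primrec.eq.decide.comp
      (Primrec.fst.comp (Primrec.unpair.comp (Primrec.snd.comp Primrec.fst)))
      (Primrec.fst.comp (Primrec.unpair.comp Primrec.snd))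

theorem primrec_evalAll : Primrec evalAll := by
  refine Primrec.ite (PrimrecPred.exists_mem_list
    (Primrec.eq.comp Primrec.id (Primrec.const none))) (Primrec.const none) ?_
  exact Primrec.option_some.comp (PrimrecPred.decide (PrimrecPred.forall_mem_list
    (Primrec.eq.comp Primrec.id (Primrec.const (some true)))))

theorem primrec_evalStep : Primrec₂ evalStep := by
  have h : Primrec fun p : (ℕ × List ℕ) × List (Option Bool) => p.1.1.unpair :=
    Primrec.unpair.comp (Primrec.fst.comp Primrec.fst)
  have htag (i : ℕ) : PrimrecPred fun p : (ℕ × List ℕ) × List (Option Bool) =>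
      p.1.1.unpair.1 = i := Primrec.eq.comp (Primrec.fst.comp h) (Primrec.const i)
  refine Primrec.ite (htag 0) (Primrec.ite ?_ (Primrec.const _) (Primrec.const none)) <|
    Primrec.ite (htag 1) ?_ <| Primrec.ite (htag 2) ?_ <| Primrec.ite (htag 3) ?_ <|
      Primrec.ite (htag 4) ?_ (Primrec.const none)
  · exact Primrec.eq.comp (Primrec.snd.comp h) (Primrec.const 0)
  · exact primrec_evalEqual.comp (Primrec.snd.comp Primrec.fst) (Primrec.snd.comp h)
  · exact primrec_evalRel.comp (Primrec.snd.comp Primrec.fst) (Primrec.snd.comp h)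
  · exact (Primrec.dom_finite evalImp).comp
      (((Primrec.list_getD none).comp Primrec.snd (Primrec.const 0)).pair
        ((Primrec.list_getD none).comp Primrec.snd (Primrec.const 1)))
  · exact primrec_evalAll.comp Primrec.snd

theorem primrec_evalCalls : Primrec₂ evalCalls := by
  have h : Primrec fun p : List ℕ × ℕ × List ℕ => p.2.1.unpair :=
    Primrec.unpair.comp (Primrec.fst.comp Primrec.snd)
  have h' : Primrec fun p : List ℕ × ℕ × List ℕ => p.2.1.unpair.2.unpair :=
    Primrec.unpair.comp (Primrec.snd.comp h)
  have htag (i : ℕ) : PrimrecPred fun p : List ℕ × ℕ × List ℕ =>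
      p.2.1.unpair.1 = i := Primrec.eq.comp (Primrec.fst.comp h) (Primrec.const i)
  refine Primrec.ite (htag 3) ?_ (Primrec.ite (htag 4) ?_ (Primrec.const []))
  · exact Primrec.list_cons.comp ((Primrec.fst.comp h').pair (Primrec.snd.comp Primrec.snd))
      (Primrec.list_cons.comp ((Primrec.snd.comp h').pair (Primrec.snd.comp Primrec.snd))
        (Primrec.const []))
  · exact Primrec.list_map Primrec.fst
      (((Primrec.snd.comp (h.comp Primrec.fst))).pair
        (Primrec.list_concat.comp (Primrec.snd.comp (Primrec.snd.comp Primrec.fst)) Primrec.snd))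

theorem primrec_evalCode : Primrec₂ evalCode :=
  Primrec.nat_omega_rec evalCode (m := fun _ b => b.1)
    (g := fun _ p => some (evalStep p.1 p.2))
    (Primrec.fst.comp Primrec.snd) primrec_evalCalls
    (Primrec.option_some.comp (primrec_evalStep.comp (Primrec.fst.comp Primrec.snd)
      (Primrec.snd.comp Primrec.snd)))
    (fun _ _ _ h => lt_of_mem_evalCalls h) (fun els b => by rw [evalCode_eq])

/-! Formula codes in the language of `J`. -/

theorem exists_eq_var {k : ℕ} (t : LE.Term (Empty ⊕ Fin k)) : ∃ i : Fin k, t = &i := by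
  rcases t with (e | i) | ⟨f, _⟩
  · exact e.elim
  · exact ⟨i, rfl⟩
  · exact f.elim

theorem termCode_var {k : ℕ} (i : Fin k) :
    termCode (&i : LE.Term (Empty ⊕ Fin k)) = Nat.pair 0 i := by
  simp [termCode]

theorem evalVar_ofFn {k : ℕ} (v : Fin k → ℕ) (i : Fin k) :
    evalVar (List.ofFn v) (Nat.pair 0 i) = some (v i) := by
  simp [evalVar]

theorem exists_of_evalVar {env : List ℕ} {t x : ℕ} (h : evalVar env t = some x) :
    ∃ i : Fin env.length, t = termCode (&i : LE.Term (Empty ⊕ Fin env.length)) := by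
  unfold evalVar at h
  split_ifs at h with h0
  obtain ⟨hi, -⟩ := List.getElem?_eq_some_iff.1 h
  refine ⟨⟨_, hi⟩, ?_⟩
  rw [termCode_var, ← h0, Nat.pair_unpair]

theorem formulaCode_rel {k : ℕ} (R : LE.Relations 2) (ts : Fin 2 → LE.Term (Empty ⊕ Fin k)) :
    formulaCode (BoundedFormula.rel R ts) = Nat.pair 2 (Nat.pair 2 (Nat.pair 0
      (Encodable.encode [termCode (ts 0), termCode (ts 1)]))) := by
  rw [formulaCode]
  have : Encodable.encode R = 0 := rfl
  simp [this, List.ofFn_succ]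

theorem argCodes_encode (s t : ℕ) : argCodes (Encodable.encode [s, t]) = (s, t) := by
  simp [argCodes, Encodable.encode_list_cons]

theorem evalCode_formulaCode {els : List ℕ} {k : ℕ} (φ : LE.BoundedFormula Empty k)
    (v : Fin k → {x | x ∈ els}) [Decidable (φ.Realize default v)] :
    evalCode els (formulaCode φ, List.ofFn fun i => (v i : ℕ)) =
      some (decide (φ.Realize default v)) := by
  classical
  induction φ with
  | falsum => rw [evalCode_eq]; simp [evalStep, formulaCode]; exact id
  | equal t₁ t₂ =>
    obtain ⟨i, rfl⟩ := exists_eq_var t₁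
    obtain ⟨j, rfl⟩ := exists_eq_var t₂
    rw [evalCode_eq]
    simp only [evalStep, formulaCode, Nat.unpair_pair, one_ne_zero, if_false, if_true, evalEqual,
      termCode_var, evalVar_ofFn, BoundedFormula.Realize]
    simp [Subtype.ext_iff]
  | @rel k l R ts =>
    obtain rfl : l = 2 := by cases R; rfl
    obtain ⟨i, hi⟩ := exists_eq_var (ts 0)
    obtain ⟨j, hj⟩ := exists_eq_var (ts 1)
    rw [evalCode_eq, formulaCode_rel, hi, hj]
    simp only [evalStep, Nat.unpair_pair, OfNat.ofNat_ne_zero, OfNat.ofNat_ne_one, if_false,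
      if_true, evalRel, argCodes_encode, termCode_var, evalVar_ofFn, BoundedFormula.Realize]
    cases R
    simp [Structure.RelMap, hi, hj]
  | imp φ₁ φ₂ ih₁ ih₂ =>
    rw [evalCode_eq]
    simp only [evalStep, formulaCode, Nat.unpair_pair, evalCalls]
    simp [ih₁, ih₂, evalImp, BoundedFormula.realize_imp]
  | @all k φ ih =>
    rw [evalCode_eq]
    have h (x : {x | x ∈ els}) : evalCode els
        (formulaCode φ, (List.ofFn fun i => (v i : ℕ)) ++ [(x : ℕ)]) =
        some (decide (φ.Realize default (Fin.snoc v x))) := by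
      rw [← ih (Fin.snoc v x), List.ofFn_succ']
      simp
    have h0 : ∀ r ∈ els.map fun x => evalCode els
        (formulaCode φ, (List.ofFn fun i => (v i : ℕ)) ++ [x]), r ≠ none := by
      intro r hr
      obtain ⟨x, hx, rfl⟩ := List.mem_map.1 hr
      rw [h ⟨x, hx⟩]
      simp
    have h1 : (∀ r ∈ els.map fun x => evalCode els
        (formulaCode φ, (List.ofFn fun i => (v i : ℕ)) ++ [x]), r = some true) ↔
        φ.all.Realize default v := by
      rw [BoundedFormula.realize_all, List.forall_mem_map]
      constructor
      · intro H x
        simpa [h x] using H x x.2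
      · intro H x hx
        simpa [h ⟨x, hx⟩] using H ⟨x, hx⟩
    simp only [evalStep, formulaCode, Nat.unpair_pair, evalCalls]
    simp only [OfNat.ofNat_ne_zero, OfNat.ofNat_ne_one, Nat.reduceEqDiff, if_false, if_true,
      List.map_map, Function.comp_def]
    rw [evalAll, if_neg fun ⟨r, hr, e⟩ => h0 r hr e]
    simp only [h1]

/-- Evaluation thus also checks syntax. The universe must be nonempty: over an empty one a
quantifier would never inspect its body. -/
theorem exists_formulaCode_of_evalCode {els : List ℕ} (hels : els ≠ []) {c k : ℕ} {env : List ℕ}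
    (hk : env.length = k) (h : evalCode els (c, env) ≠ none) :
    ∃ φ : LE.BoundedFormula Empty k, formulaCode φ = c := by
  induction c using Nat.strong_induction_on generalizing env k with
  | _ c ih =>
    subst hk
    have hc := Nat.pair_unpair c
    have hcalls (b : ℕ × List ℕ) (hb : b ∈ evalCalls els (c, env)) :
        b.1 < c := lt_of_mem_evalCalls hb
    rw [evalCode_eq] at h
    simp only [evalStep] at h
    split_ifs at h with h0 h0' h1 h2 h3 h4
    · rw [h0, h0'] at hc
      exact ⟨BoundedFormula.falsum, by rw [formulaCode, hc]⟩
    · exact (h rfl).elim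
    · obtain ⟨r, hr⟩ := Option.ne_none_iff_exists'.1 h
      simp only [evalEqual, Option.bind_eq_some_iff, Option.map_eq_some_iff] at hr
      obtain ⟨x, hx, y, hy, -⟩ := hr
      obtain ⟨i, hi⟩ := exists_of_evalVar hx
      obtain ⟨j, hj⟩ := exists_of_evalVar hy
      refine ⟨BoundedFormula.equal (&i) (&j), ?_⟩
      rw [formulaCode, ← hi, ← hj, Nat.pair_unpair, ← h1, Nat.pair_unpair]
    · obtain ⟨r, hr⟩ := Option.ne_none_iff_exists'.1 h
      unfold evalRel at hr
      split_ifs at hr with hp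
      simp only [Option.bind_eq_some_iff, Option.map_eq_some_iff] at hr
      obtain ⟨x, hx, y, hy, -⟩ := hr
      obtain ⟨i, hi⟩ := exists_of_evalVar hx
      obtain ⟨j, hj⟩ := exists_of_evalVar hy
      refine ⟨BoundedFormula.rel symE ![&i, &j], ?_⟩
      rw [formulaCode_rel]
      simp only [Matrix.cons_val_zero, Matrix.cons_val_one, ← hi, ← hj]
      rw [← hp, ← h2, Nat.pair_unpair]
    · obtain ⟨r, hr⟩ := Option.ne_none_iff_exists'.1 h
      simp only [evalCalls, if_pos h3] at hcalls hr
      simp only [List.map_cons, List.map_nil, List.getD_cons_zero, List.getD_cons_succ] at hr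
      obtain ⟨φ₁, h₁⟩ := ih _ (hcalls (_, env) (by simp; exact .inl rfl)) rfl
        (by intro e; rw [e] at hr; simp [evalImp] at hr)
      obtain ⟨φ₂, h₂⟩ := ih _ (hcalls (_, env) (by simp; exact .inr rfl)) rfl
        (by intro e; rw [e] at hr; simp [evalImp] at hr)
      refine ⟨φ₁.imp φ₂, ?_⟩
      rw [formulaCode, h₁, h₂, Nat.pair_unpair, ← h3, Nat.pair_unpair]
    · obtain ⟨x, hx⟩ := List.exists_mem_of_ne_nil els hels
      have hmem : (c.unpair.2, env ++ [x]) ∈ evalCalls els (c, env) := by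
        simp only [evalCalls, if_neg h3, if_pos h4]
        exact List.mem_map.2 ⟨x, hx, rfl⟩
      obtain ⟨φ, hφ⟩ := ih _ (hcalls _ hmem) (k := env.length + 1) List.length_append (by
        intro e
        exact h (if_pos ⟨_, List.mem_map.2 ⟨_, hmem, e⟩, rfl⟩))
      exact ⟨φ.all, by rw [formulaCode, hφ, ← h4, Nat.pair_unpair]⟩
    · exact (h rfl).elim

/-! ### The models of `J` -/

section Models

variable {M N : Type} [LE.Structure M] [LE.Structure N]

/-- The interpretation of `E`. -/
def EqvRel (x y : M) : Prop := Structure.RelMap symE ![x, y]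

/-- The equivalence class of `x`. -/
def eqvClass (x : M) : Set M := {y | EqvRel x y}

theorem realize_fE {k : ℕ} (i j : Fin k) (v : Empty → M) (xs : Fin k → M) :
    (fE i j).Realize v xs ↔ EqvRel (xs i) (xs j) := by
  simp [fE, BoundedFormula.realize_rel₂, EqvRel]

theorem realize_fEq {k : ℕ} (i j : Fin k) (v : Empty → M) (xs : Fin k → M) :
    (fEq i j).Realize v xs ↔ xs i = xs j := by
  simp [fEq]

theorem realize_conj {k : ℕ} (l : List (LE.BoundedFormula Empty k)) (v : Empty → M)
    (xs : Fin k → M) : (conj l).Realize v xs ↔ ∀ φ ∈ l, φ.Realize v xs :=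
  BoundedFormula.realize_foldr_inf l v xs

theorem realize_exN {k n : ℕ} (φ : LE.BoundedFormula Empty (k + n)) (v : Empty → M)
    (xs : Fin k → M) : (exN n φ).Realize v xs ↔ ∃ ys : Fin n → M, φ.Realize v (Fin.append xs ys) := by
  induction n with
  | zero =>
    rw [exN, Fin.exists_fin_zero_pi, Fin.append_right_nil _ _ rfl]
    rfl
  | succ n ih =>
    rw [exN, ih]
    simp only [BoundedFormula.realize_ex]
    constructor
    · rintro ⟨ys, z, h⟩
      refine ⟨Fin.snoc ys z, ?_⟩
      rwa [Fin.append_snoc]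
    · rintro ⟨ys, h⟩
      refine ⟨Fin.init ys, ys (Fin.last n), ?_⟩
      rwa [← Fin.append_snoc, Fin.snoc_init_self]

theorem mem_ltPairs {n : ℕ} {p : Fin n × Fin n} : p ∈ ltPairs n ↔ p.1 < p.2 := by
  rw [ltPairs, List.mem_filter, decide_eq_true_iff, and_iff_right_iff_imp]
  exact fun _ => List.pair_mem_product.2 ⟨List.mem_finRange _, List.mem_finRange _⟩

theorem forall_ltPairs {n : ℕ} {r : Fin n → Fin n → Prop} (hr : ∀ i j, r i j → r j i) :
    (∀ p ∈ ltPairs n, ¬ r p.1 p.2) ↔ ∀ i j, i ≠ j → ¬ r i j := by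
  simp only [mem_ltPairs, Prod.forall]
  constructor
  · intro h i j hij hr'
    rcases lt_or_gt_of_ne hij with hlt | hlt
    · exact h i j hlt hr'
    · exact h j i hlt (hr _ _ hr')
  · intro h i j hij
    exact h i j hij.ne

theorem le_encard_iff {α : Type*} {s : Set α} {n : ℕ} :
    (n : ℕ∞) ≤ s.encard ↔ ∃ ys : Fin n → α, (∀ j, ys j ∈ s) ∧ Function.Injective ys := by
  constructor
  · intro h
    obtain ⟨t, hts, ht⟩ := Set.exists_subset_encard_eq h
    have hfin : t.Finite := Set.finite_of_encard_eq_coe ht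
    have hc : Nat.card t = n := by
      rw [Nat.card_coe_set_eq, Set.ncard_def, ht]; rfl
    have := hfin.to_subtype
    let e := (Finite.equivFinOfCardEq hc).symm
    exact ⟨fun j => e j, fun j => hts (e j).2, Subtype.val_injective.comp e.injective⟩
  · rintro ⟨ys, hys, hinj⟩
    have := Set.encard_le_encard (Set.range_subset_iff.2 hys)
    rwa [← Set.image_univ, hinj.encard_image, Set.encard_univ, ENat.card_eq_coe_fintype_card,
      Fintype.card_fin] at this

theorem realize_classGe {k n : ℕ} (i : Fin k) (v : Empty → M) (xs : Fin k → M) :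
    (classGe i n).Realize v xs ↔ (n : ℕ∞) ≤ (eqvClass (xs i)).encard := by
  rw [classGe, realize_exN, le_encard_iff]
  refine exists_congr fun ys => ?_
  simp only [BoundedFormula.realize_inf, realize_conj, List.forall_mem_map, List.mem_finRange,
    true_imp_iff, realize_fE, realize_fEq, BoundedFormula.realize_not, Fin.append_left,
    Fin.append_right]
  rw [forall_ltPairs (r := fun i j => ys i = ys j) fun _ _ h => h.symm]
  refine and_congr Iff.rfl ⟨fun h i j e => by_contra fun hij => h i j hij e, fun h i j hij e =>
    hij (h e)⟩

theorem realize_classEq {k n : ℕ} (i : Fin k) (v : Empty → M) (xs : Fin k → M) :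
    (classEq i n).Realize v xs ↔ (eqvClass (xs i)).encard = n := by
  rw [classEq, BoundedFormula.realize_inf, BoundedFormula.realize_not, realize_classGe,
    realize_classGe, not_le, Nat.cast_add, Nat.cast_one, ENat.lt_add_one_iff (ENat.natCast_ne_top n),
    le_antisymm_iff, and_comm]

theorem realize_sA {n : ℕ} : M ⊨ sA n ↔ ∃ x : M, (eqvClass x).encard = (n + 1 : ℕ) := by
  rw [sA, Sentence.Realize, Formula.Realize, BoundedFormula.realize_ex]
  refine exists_congr fun x => ?_
  rw [realize_classEq]
  rfl

theorem realize_J2 {n : ℕ} : M ⊨ J2 n ↔ ∀ x y : M, (eqvClass x).encard = n →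
    (eqvClass y).encard = n → EqvRel x y := by
  rw [J2, Sentence.Realize, Formula.Realize, BoundedFormula.realize_all]
  refine forall_congr' fun x => ?_
  rw [BoundedFormula.realize_all]
  refine forall_congr' fun y => ?_
  rw [BoundedFormula.realize_imp, BoundedFormula.realize_inf, realize_classEq, realize_classEq,
    realize_fE, and_imp]
  rfl

theorem realize_J3 {n : ℕ} (hE : Equivalence (EqvRel : M → M → Prop)) : M ⊨ J3 n ↔
    ∃ xs : Fin n → M, (∀ i, (n : ℕ∞) ≤ (eqvClass (xs i)).encard) ∧
      ∀ i j, i ≠ j → ¬ EqvRel (xs i) (xs j) := by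
  rw [J3, Sentence.Realize, BoundedFormula.realize_exs]
  refine exists_congr fun xs => ?_
  simp only [BoundedFormula.realize_inf, realize_conj, List.forall_mem_map, List.mem_finRange,
    true_imp_iff, realize_classGe, realize_fE, BoundedFormula.realize_not]
  rw [forall_ltPairs (r := fun i j => EqvRel (xs i) (xs j)) fun _ _ h => hE.symm h]

variable (M) in
/-- The axioms of `J` for class sizes up to `K`. -/
structure IsModelUpTo (K : ℕ) : Prop where
  equivalence : Equivalence (EqvRel : M → M → Prop)
  unique : ∀ n < K, ∀ x y : M, (eqvClass x).encard = n → (eqvClass y).encard = n → EqvRel x y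
  large : ∃ xs : Fin K → M, (∀ i, (K : ℕ∞) ≤ (eqvClass (xs i)).encard) ∧
    ∀ i j, i ≠ j → ¬ EqvRel (xs i) (xs j)

theorem realize_equivalence : (M ⊨ symE.reflexive ∧ M ⊨ symE.symmetric ∧ M ⊨ symE.transitive) ↔
    Equivalence (EqvRel : M → M → Prop) := by
  rw [Relations.realize_reflexive, Relations.realize_symmetric, Relations.realize_transitive]
  exact ⟨fun h => ⟨h.1.refl, fun {_ _} => h.2.1.symm _ _, fun {_ _ _} => h.2.2.trans _ _ _⟩,
    fun h => ⟨⟨h.refl⟩, ⟨fun _ _ => h.symm⟩, ⟨fun _ _ _ => h.trans⟩⟩⟩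

theorem model_J_iff : M ⊨ J ↔ ∀ K, IsModelUpTo M K := by
  simp only [Theory.model_iff, J, Set.mem_union, Set.mem_insert_iff, Set.mem_singleton_iff,
    Set.mem_range]
  constructor
  · intro h K
    have hE : Equivalence (EqvRel : M → M → Prop) := realize_equivalence.1
      ⟨h _ (.inl (.inl (.inl rfl))), h _ (.inl (.inl (.inr (.inl rfl)))),
        h _ (.inl (.inl (.inr (.inr rfl))))⟩
    exact ⟨hE, fun n _ => realize_J2.1 (h _ (.inl (.inr ⟨n, rfl⟩))),
      (realize_J3 hE).1 (h _ (.inr ⟨K, rfl⟩))⟩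
  · intro h
    obtain ⟨h1, h2, h3⟩ := realize_equivalence.2 (h 0).equivalence
    rintro φ (((rfl | rfl | rfl) | ⟨n, rfl⟩) | ⟨n, rfl⟩)
    · exact h1
    · exact h2
    · exact h3
    · exact realize_J2.2 ((h (n + 1)).unique n n.lt_succ_self)
    · exact (realize_J3 (h 0).equivalence).2 (h n).large

/-! ### Back-and-forth between models with the same small class sizes -/

theorem eqvClass_eq (hE : Equivalence (EqvRel : M → M → Prop)) {x y : M} (h : EqvRel x y) :
    eqvClass x = eqvClass y := by
  ext z
  exact ⟨fun hz => hE.trans (hE.symm h) hz, fun hz => hE.trans h hz⟩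

/-- The tuples `xs` and `ys` satisfy the same atomic formulas, and corresponding entries have
classes of the same size, where the sizes from `K` on are identified. -/
structure Matched (K : ℕ) {n : ℕ} (xs : Fin n → M) (ys : Fin n → N) : Prop where
  eq_iff : ∀ i j, xs i = xs j ↔ ys i = ys j
  rel_iff : ∀ i j, EqvRel (xs i) (xs j) ↔ EqvRel (ys i) (ys j)
  size_iff : ∀ i, ∀ m ≤ K, (m : ℕ∞) ≤ (eqvClass (xs i)).encard ↔
    (m : ℕ∞) ≤ (eqvClass (ys i)).encard

theorem Matched.symm {K n : ℕ} {xs : Fin n → M} {ys : Fin n → N} (h : Matched K xs ys) :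
    Matched K ys xs :=
  ⟨fun i j => (h.eq_iff i j).symm, fun i j => (h.rel_iff i j).symm,
    fun i m hm => (h.size_iff i m hm).symm⟩

variable (M N) in
/-- `M` and `N` have classes of the same sizes below `K`. -/
def SameSizes (K : ℕ) : Prop :=
  ∀ n < K, (∃ x : M, (eqvClass x).encard = n) ↔ ∃ y : N, (eqvClass y).encard = n

theorem Matched.snoc {K n : ℕ} {xs : Fin n → M} {ys : Fin n → N} (h : Matched K xs ys)
    (hM : Equivalence (EqvRel : M → M → Prop)) (hN : Equivalence (EqvRel : N → N → Prop))
    {c : M} {d : N} (he : ∀ i, xs i = c ↔ ys i = d) (hr : ∀ i, EqvRel (xs i) c ↔ EqvRel (ys i) d)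
    (hs : ∀ m ≤ K, (m : ℕ∞) ≤ (eqvClass c).encard ↔ (m : ℕ∞) ≤ (eqvClass d).encard) :
    Matched (M := M) (N := N) K (Fin.snoc xs c : Fin (n + 1) → M) (Fin.snoc ys d) := by
  constructor
  · intro i j
    induction i using Fin.lastCases <;> induction j using Fin.lastCases <;>
      simp [h.eq_iff, he, eq_comm (a := c), eq_comm (a := d)]
  · intro i j
    have hMc (x y : M) : EqvRel x y ↔ EqvRel y x := ⟨hM.symm, hM.symm⟩
    have hNc (x y : N) : EqvRel x y ↔ EqvRel y x := ⟨hN.symm, hN.symm⟩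
    induction i using Fin.lastCases <;> induction j using Fin.lastCases <;>
      simp [h.rel_iff, hr, hMc c, hNc d, hM.refl, hN.refl]
  · intro i
    induction i using Fin.lastCases with
    | last => simpa using hs
    | cast i => simpa using h.size_iff i

/-- The forth step of the Ehrenfeucht–Fraïssé game. A new `c` in the class of some entry is answered
inside the corresponding class, which is large enough because sizes agree up to `K` and fewer than
`K` elements are in use. A `c` in a fresh class of size below `K` is answered by the class of that
size in `N`; in a fresh class of size at least `K`, by one of the `K` large classes that no entry
meets. -/
theorem Matched.exists_snoc {K n : ℕ} {xs : Fin n → M} {ys : Fin n → N} (h : Matched K xs ys)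
    (hM : IsModelUpTo M K) (hN : IsModelUpTo N K) (hMN : SameSizes M N K) (hn : n < K) (c : M) :
    ∃ d : N, Matched (M := M) (N := N) K (Fin.snoc xs c : Fin (n + 1) → M) (Fin.snoc ys d) := by
  classical
  have hE := hM.equivalence
  have hE' := hN.equivalence
  by_cases hc : ∃ i, EqvRel (xs i) c
  · obtain ⟨i, hi⟩ := hc
    by_cases hcx : ∃ j, xs j = c
    · obtain ⟨j, rfl⟩ := hcx
      exact ⟨ys j, h.snoc hE hE' (fun i => h.eq_iff i j) (fun i => h.rel_iff i j) (h.size_iff j)⟩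
    · push Not at hcx
      let I : Finset (Fin n) := Finset.univ.filter fun j => EqvRel (xs i) (xs j)
      have hIn : I.card ≤ n := by simpa using I.card_le_univ
      -- Equal entries of `xs` have equal counterparts in `ys`, so the used elements of `N` are an
      -- image of those of `M`.
      have hcard : (I.image ys).card ≤ (I.image xs).card := by
        have hf : Function.FactorsThrough ys xs := fun i j e => (h.eq_iff i j).1 e
        have : I.image ys = (I.image xs).image (Function.extend xs ys fun _ => ys i) := by
          rw [Finset.image_image]
          exact Finset.image_congr fun j _ => (hf.extend_apply _ j).symm
        rw [this]
        exact Finset.card_image_le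
      have hlt : ((I.image xs).card + 1 : ℕ) ≤ (eqvClass (xs i)).encard := by
        have hsub : (↑(insert c (I.image xs)) : Set M) ⊆ eqvClass (xs i) := by
          intro z hz
          rcases by simpa using hz with rfl | ⟨j, hj, rfl⟩
          · exact hi
          · exact (Finset.mem_filter.1 hj).2
        have := Set.encard_le_encard hsub
        rwa [Set.encard_coe_eq_coe_finsetCard, Finset.card_insert_of_notMem (by
          simpa using fun j _ => hcx j)] at this
      have hle : (I.image xs).card + 1 ≤ K := by
        have := Finset.card_image_le (s := I) (f := xs)
        omega
      have hlt' := (h.size_iff i _ hle).1 hlt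
      obtain ⟨d, hd, hdI⟩ : ∃ d ∈ eqvClass (ys i), d ∉ I.image ys := by
        by_contra! hcon
        have := hlt'.trans (Set.encard_le_encard (t := ↑(I.image ys))
          fun d hd => Finset.mem_coe.2 (hcon d hd))
        rw [Set.encard_coe_eq_coe_finsetCard, Nat.cast_le] at this
        omega
      refine ⟨d, h.snoc hE hE' (fun j => iff_of_false (hcx j) ?_) (fun j => ?_) ?_⟩
      · rintro rfl
        exact hdI (Finset.mem_image.2 ⟨j, Finset.mem_filter.2
          ⟨Finset.mem_univ _, (h.rel_iff _ _).2 hd⟩, rfl⟩)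
      · have h1 : EqvRel (xs j) c ↔ EqvRel (xs j) (xs i) :=
          ⟨fun h => hE.trans h (hE.symm hi), fun h => hE.trans h hi⟩
        have h2 : EqvRel (ys j) d ↔ EqvRel (ys j) (ys i) :=
          ⟨fun h => hE'.trans h (hE'.symm hd), fun h => hE'.trans h hd⟩
        rw [h1, h2, h.rel_iff]
      · rw [← eqvClass_eq hE hi, ← eqvClass_eq hE' hd]
        exact h.size_iff i
  · push Not at hc
    obtain ⟨d, hd, hds⟩ : ∃ d : N, (∀ i, ¬ EqvRel (ys i) d) ∧
        ∀ m ≤ K, (m : ℕ∞) ≤ (eqvClass c).encard ↔ (m : ℕ∞) ≤ (eqvClass d).encard := by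
      rcases lt_or_ge (eqvClass c).encard K with hlt | hge
      · obtain ⟨k, hk⟩ := ENat.ne_top_iff_exists.1 (ne_top_of_lt hlt)
        rw [← hk, Nat.cast_lt] at hlt
        obtain ⟨d, hd⟩ := (hMN k hlt).1 ⟨c, hk.symm⟩
        refine ⟨d, fun i hi => ?_, fun m _ => by rw [← hk, hd]⟩
        -- If `d` lay in the class of `ys i`, that of `xs i` would also have size k, and uniqueness
        -- of this size in `M` would make `xs i` equivalent to `c`.
        have hdi : (eqvClass (ys i)).encard = k := by rw [eqvClass_eq hE' hi, hd]
        have h1 := (h.size_iff i k hlt.le).2 hdi.ge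
        have h2 := mt (h.size_iff i (k + 1) hlt).1
          (by rw [hdi, Nat.cast_le]; omega)
        have h3 : (eqvClass (xs i)).encard = k := by
          refine le_antisymm ?_ h1
          rw [not_le, Nat.cast_add, Nat.cast_one, ENat.lt_add_one_iff (ENat.natCast_ne_top k)] at h2
          exact h2
        exact hc i (hM.unique k hlt _ _ h3 hk.symm)
      · obtain ⟨zs, hzs, hzne⟩ := hN.large
        -- Pigeonhole: `K` pairwise inequivalent elements cannot all be equivalent to entries of a
        -- tuple of length n < `K`.
        have : ∃ j, ∀ i, ¬ EqvRel (ys i) (zs j) := by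
          by_contra! hcon
          choose f hf using hcon
          have hinj : Function.Injective f := fun j j' e => by
            by_contra hne
            exact hzne j j' hne (hE'.trans (hE'.symm (hf j)) (e ▸ hf j'))
          have := Fintype.card_le_of_injective f hinj
          simp at this
          omega
        obtain ⟨j, hj⟩ := this
        refine ⟨zs j, hj, fun m hm => iff_of_true ?_ ?_⟩
        · exact (Nat.cast_le.2 hm).trans hge
        · exact (Nat.cast_le.2 hm).trans (hzs j)
    refine ⟨d, h.snoc hE hE' (fun i => iff_of_false ?_ ?_)
      (fun i => iff_of_false (hc i) (hd i)) hds⟩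
    · exact fun e => hc i (e ▸ hE.refl _)
    · exact fun e => hd i (e ▸ hE'.refl _)

/-- The Gödel number serves as a crude bound on quantifier depth: since `Nat.pair 4 c ≥ 4 + c`,
passing under a quantifier lengthens the tuple by one but lowers the number by more. -/
theorem Matched.realize_iff {K n : ℕ} (hM : IsModelUpTo M K) (hN : IsModelUpTo N K)
    (hMN : SameSizes M N K) (φ : LE.BoundedFormula Empty n) (hK : n + formulaCode φ ≤ K)
    {xs : Fin n → M} {ys : Fin n → N} (h : Matched K xs ys) :
    φ.Realize default xs ↔ φ.Realize default ys := by
  induction φ with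
  | falsum => exact Iff.rfl
  | equal t₁ t₂ =>
    obtain ⟨i, rfl⟩ := exists_eq_var t₁
    obtain ⟨j, rfl⟩ := exists_eq_var t₂
    simpa [BoundedFormula.Realize] using h.eq_iff i j
  | @rel k l R ts =>
    obtain rfl : l = 2 := by cases R; rfl
    obtain ⟨i, hi⟩ := exists_eq_var (ts 0)
    obtain ⟨j, hj⟩ := exists_eq_var (ts 1)
    have hts : ts = ![&i, &j] := by
      funext k; fin_cases k <;> simp [hi, hj]
    subst hts
    cases R
    exact (realize_fE i j _ _).trans ((h.rel_iff i j).trans (realize_fE i j _ _).symm)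
  | imp φ₁ φ₂ ih₁ ih₂ =>
    have h1 := Nat.add_le_pair 3 (Nat.pair (formulaCode φ₁) (formulaCode φ₂))
    have h2 := Nat.add_le_pair (formulaCode φ₁) (formulaCode φ₂)
    rw [formulaCode] at hK
    rw [BoundedFormula.realize_imp, BoundedFormula.realize_imp, ih₁ (by omega) h,
      ih₂ (by omega) h]
  | all φ ih =>
    have h1 := Nat.add_le_pair 4 (formulaCode φ)
    rw [formulaCode] at hK
    rw [BoundedFormula.realize_all, BoundedFormula.realize_all]
    constructor
    · intro H d
      obtain ⟨c, hc⟩ := h.symm.exists_snoc hN hM (fun n hn => (hMN n hn).symm) (by omega) d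
      exact (ih (by omega) hc.symm).1 (H c)
    · intro H c
      obtain ⟨d, hd⟩ := h.exists_snoc hM hN hMN (by omega) c
      exact (ih (by omega) hd).2 (H d)

theorem realize_sentence_iff_of_sameSizes {K : ℕ} (hM : IsModelUpTo M K) (hN : IsModelUpTo N K)
    (hMN : SameSizes M N K) (φ : LE.Sentence) (hK : formulaCode φ ≤ K) : M ⊨ φ ↔ N ⊨ φ :=
  Matched.realize_iff hM hN hMN φ (by omega)
    ⟨fun i => i.elim0, fun i => i.elim0, fun i => i.elim0⟩

end Models

/-! ### Standard models -/

/-- The set of numbers whose first coordinate `c` ranges over all classes and whose second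
coordinate ranges over the `w c` elements of that class. -/
def stdModel (w : ℕ → ℕ∞) : Set ℕ := {x | (x.unpair.2 : ℕ∞) < w x.unpair.1}

theorem eqvRel_iff {D : Set ℕ} {x y : D} :
    EqvRel x y ↔ (x : ℕ).unpair.1 = (y : ℕ).unpair.1 := Iff.rfl

theorem encard_setOf_lt (v : ℕ∞) : {j : ℕ | (j : ℕ∞) < v}.encard = v := by
  induction v using ENat.recTopCoe with
  | top => simp
  | coe n =>
    have : {j : ℕ | (j : ℕ∞) < n} = ↑(Finset.range n) := by ext; simp
    rw [this, Set.encard_coe_eq_coe_finsetCard, Finset.card_range]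

theorem encard_eqvClass_stdModel {w : ℕ → ℕ∞} (x : stdModel w) :
    (eqvClass x).encard = w (x : ℕ).unpair.1 := by
  have hinj : Function.Injective (Nat.pair (x : ℕ).unpair.1) := fun i j h => by simpa using h
  have hw := hinj.encard_image {j : ℕ | (j : ℕ∞) < w (x : ℕ).unpair.1}
  rw [encard_setOf_lt] at hw
  rw [← Subtype.val_injective.encard_image]
  refine Eq.trans ?_ hw
  congr 1
  ext y
  constructor
  · rintro ⟨z, hz, rfl⟩
    have hz' : (x : ℕ).unpair.1 = (z : ℕ).unpair.1 := hz
    refine ⟨(z : ℕ).unpair.2, ?_, ?_⟩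
    · rw [Set.mem_ofPred_eq, hz']
      exact z.2
    · rw [hz', Nat.pair_unpair]
  · rintro ⟨j, hj, rfl⟩
    refine ⟨⟨Nat.pair (x : ℕ).unpair.1 j, ?_⟩, ?_, rfl⟩
    · simpa [stdModel] using hj
    · change (x : ℕ).unpair.1 = (Nat.pair (x : ℕ).unpair.1 j).unpair.1
      rw [Nat.unpair_pair]

/-- Class sizes: one class of size `n + 1` for each `n ∈ S` with `n < κ`, and `κ` classes of
size `κ`. -/
noncomputable def stdSize (S : Set ℕ) (κ : ℕ∞) (c : ℕ) : ℕ∞ :=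
  open Classical in
  if ((c / 2 : ℕ) : ℕ∞) < κ then
    if c % 2 = 1 then κ else if c / 2 ∈ S then ((c / 2 + 1 : ℕ) : ℕ∞) else 0
  else 0

theorem stdSize_odd {S : Set ℕ} {κ : ℕ∞} {i : ℕ} (hi : (i : ℕ∞) < κ) :
    stdSize S κ (2 * i + 1) = κ := by
  have h1 : (2 * i + 1) / 2 = i := by omega
  rw [stdSize, h1, if_pos hi, if_pos (by omega)]

theorem stdSize_even {S : Set ℕ} {κ : ℕ∞} {i : ℕ} (hi : (i : ℕ∞) < κ) (hS : i ∈ S) :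
    stdSize S κ (2 * i) = (i + 1 : ℕ) := by
  have h1 : 2 * i / 2 = i := by omega
  rw [stdSize, h1, if_pos hi, if_neg (by omega), if_pos hS]

theorem eq_of_stdSize_eq {S : Set ℕ} {κ : ℕ∞} {c n : ℕ} (hn : (n : ℕ∞) < κ) (h0 : n ≠ 0)
    (h : stdSize S κ c = n) : ∃ i ∈ S, n = i + 1 ∧ c = 2 * i := by
  have h0' : (0 : ℕ∞) ≠ n := by exact_mod_cast h0.symm
  unfold stdSize at h
  split_ifs at h with h1 h2 h3
  · exact (hn.ne h.symm).elim
  · exact ⟨c / 2, h3, (Nat.cast_inj.1 h).symm, by omega⟩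
  · exact (h0' h).elim
  · exact (h0' h).elim

theorem encard_eqvClass_ne_zero {w : ℕ → ℕ∞} (x : stdModel w) : (eqvClass x).encard ≠ 0 := by
  rw [encard_eqvClass_stdModel]
  exact (bot_le.trans_lt x.2).ne'

theorem exists_encard_stdModel {S : Set ℕ} {κ : ℕ∞} {n : ℕ} (hn : (n : ℕ∞) < κ) :
    (∃ x : stdModel (stdSize S κ), (eqvClass x).encard = n) ↔ ∃ i ∈ S, n = i + 1 := by
  constructor
  · rintro ⟨x, hx⟩
    have h0 : n ≠ 0 := by
      rintro rfl
      exact encard_eqvClass_ne_zero x (by simpa using hx)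
    rw [encard_eqvClass_stdModel] at hx
    obtain ⟨i, hi, hn, -⟩ := eq_of_stdSize_eq hn h0 hx
    exact ⟨i, hi, hn⟩
  · rintro ⟨i, hi, rfl⟩
    have hi' : (i : ℕ∞) < κ := lt_of_le_of_lt (by exact_mod_cast i.le_succ) hn
    refine ⟨⟨Nat.pair (2 * i) 0, ?_⟩, ?_⟩
    · simp [stdModel, stdSize_even hi' hi]
    · rw [encard_eqvClass_stdModel, Nat.unpair_pair, stdSize_even hi' hi]

/-- Used with κ = ⊤ for genuine models of `J`, and with κ = `K` for their finite approximations. In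
the latter, i = `K` - 1 in `S` adds another class of size `K`, which is harmless as uniqueness is
required only below `K`. -/
theorem isModelUpTo_stdModel (S : Set ℕ) {κ : ℕ∞} {K : ℕ} (hK : (K : ℕ∞) ≤ κ) :
    IsModelUpTo (stdModel (stdSize S κ)) K where
  equivalence := ⟨fun _ => rfl, fun h => Eq.symm h, fun h h' => Eq.trans h h'⟩
  unique n hn x y hx hy := by
    have h0 : n ≠ 0 := by
      rintro rfl
      exact encard_eqvClass_ne_zero x (by simpa using hx)
    have hn' : (n : ℕ∞) < κ := lt_of_lt_of_le (by exact_mod_cast hn) hK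
    rw [encard_eqvClass_stdModel] at hx hy
    obtain ⟨i, -, hi, hxi⟩ := eq_of_stdSize_eq hn' h0 hx
    obtain ⟨j, -, hj, hyj⟩ := eq_of_stdSize_eq hn' h0 hy
    rw [eqvRel_iff]
    omega
  large := by
    have h (i : Fin K) : ((i : ℕ) : ℕ∞) < κ := lt_of_lt_of_le (by exact_mod_cast i.2) hK
    refine ⟨fun i => ⟨Nat.pair (2 * i + 1) 0, ?_⟩, fun i => ?_, fun i j hij => ?_⟩
    · simpa [stdModel, stdSize_odd (h i)] using bot_le.trans_lt (h i)
    · rw [encard_eqvClass_stdModel, Nat.unpair_pair, stdSize_odd (h i)]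
      exact hK
    · rw [eqvRel_iff]
      simpa [Fin.ext_iff] using hij

theorem nonempty_stdModel (S : Set ℕ) {κ : ℕ∞} (hκ : 0 < κ) :
    Nonempty (stdModel (stdSize S κ)) :=
  ⟨⟨Nat.pair 1 0, by simpa [stdModel, stdSize_odd (i := 0) (by simpa using hκ)] using
    (stdSize_odd (S := S) (i := 0) (by simpa using hκ)) ▸ hκ⟩⟩

theorem stdModel_models_sch {a : ℕ} {S : Set ℕ} (hB : setB a ⊆ S) (hC : Disjoint (setC a) S) :
    stdModel (stdSize S ⊤) ⊨ sch a := by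
  have hA (n : ℕ) : stdModel (stdSize S ⊤) ⊨ sA n ↔ n ∈ S := by
    rw [realize_sA, exists_encard_stdModel (ENat.natCast_lt_top _)]
    simp
  have hJ : stdModel (stdSize S ⊤) ⊨ J := model_J_iff.2 fun K => isModelUpTo_stdModel S le_top
  rw [Theory.model_iff]
  rintro φ ((h | ⟨n, hn, rfl⟩) | ⟨m, hm, rfl⟩)
  · exact Theory.model_iff _ |>.1 hJ φ h
  · exact (hA n).2 (hB hn)
  · rw [Sentence.Realize, Formula.realize_not]
    exact fun h => Set.disjoint_left.1 hC hm ((hA m).1 h)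

theorem isSatisfiable_sch (a : ℕ) : (sch a).IsSatisfiable := by
  have := nonempty_stdModel (setB a) (κ := ⊤) (by simp)
  have := stdModel_models_sch (a := a) subset_rfl (disjoint_setB_setC a).symm
  exact Theory.Model.isSatisfiable (stdModel (stdSize (setB a) ⊤))

theorem sA_mem_sch {a n : ℕ} (hn : n ∈ setB a) : sA n ∈ sch a := .inl (.inr ⟨n, hn, rfl⟩)

theorem not_sA_mem_sch {a n : ℕ} (hn : n ∈ setC a) : ∼(sA n) ∈ sch a := .inr ⟨n, hn, rfl⟩

/-! ### Deciding the theorems of `sch a` -/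

/-- The set of positions of the binary digits `1` of `s`. -/
def bits (s : ℕ) : Set ℕ := {n | s / 2 ^ n % 2 = 1}

theorem exists_bits (S : Set ℕ) (K : ℕ) : ∃ s < 2 ^ K, ∀ n < K, n ∈ bits s ↔ n ∈ S := by
  classical
  refine ⟨Nat.ofBits fun i : Fin K => decide ((i : ℕ) ∈ S), Nat.ofBits_lt_two_pow _,
    fun n hn => ?_⟩
  have := Nat.testBit_ofBits_lt (fun i : Fin K => decide ((i : ℕ) ∈ S)) n hn
  rw [Nat.testBit_eq_decide_div_mod_eq, decide_eq_decide] at this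
  exact this

/-- Below `K`, the set `bits s` separates `P` from `Q`. -/
def SeparatesBelow (K : ℕ) (P Q : Set ℕ) (s : ℕ) : Prop :=
  (∀ n < K, n ∈ P → n ∈ bits s) ∧ ∀ n < K, n ∈ Q → n ∉ bits s

theorem models_sch_iff {a K : ℕ} {φ : LE.Sentence} (hK : formulaCode φ < K) :
    sch a ⊨ᵇ φ ↔ ∀ s < 2 ^ K, SeparatesBelow K (setB a) (setC a) s →
      stdModel (stdSize (bits s) K) ⊨ φ := by
  constructor
  · rintro h s - ⟨hsB, hsC⟩
    -- The finite separator is continued by ℬ beyond `K`, which gives a model of all of `sch a` with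
    -- the same class sizes below `K` as the finite structure.
    let S : Set ℕ := {n | if n < K then n ∈ bits s else n ∈ setB a}
    have hB : setB a ⊆ S := fun n hn => by
      change if n < K then n ∈ bits s else n ∈ setB a
      split_ifs with h
      exacts [hsB n h hn, hn]
    have hC : Disjoint (setC a) S := Set.disjoint_left.2 fun n hn hnS => by
      change if n < K then n ∈ bits s else n ∈ setB a at hnS
      split_ifs at hnS with h
      exacts [hsC n h hn hnS, Set.disjoint_left.1 (disjoint_setB_setC a) hnS hn]
    have := nonempty_stdModel S (κ := ⊤) (by simp)
    have := stdModel_models_sch hB hC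
    refine (realize_sentence_iff_of_sameSizes (isModelUpTo_stdModel S le_top)
      (isModelUpTo_stdModel (bits s) le_rfl) (fun n hn => ?_) φ hK.le).1
      (h.realize_sentence (stdModel (stdSize S ⊤)))
    rw [exists_encard_stdModel (ENat.natCast_lt_top _), exists_encard_stdModel (by exact_mod_cast hn)]
    refine exists_congr fun i => and_congr_left fun hi => ?_
    change (if i < K then i ∈ bits s else i ∈ setB a) ↔ _
    rw [if_pos (by omega)]
  · intro h
    rw [Theory.models_sentence_iff]
    intro M
    have hM : M ⊨ sch a := M.is_model
    have hJ : M ⊨ J := hM.mono (Set.subset_union_left.trans Set.subset_union_left)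
    have hMK := model_J_iff.1 hJ K
    -- The finite structure that mimics `M` realizes exactly the class sizes of `M` below `K`; the
    -- axioms of `sch a` make this set a separator.
    obtain ⟨s, hs, hsS⟩ := exists_bits {n | M ⊨ sA n} K
    have hsep : SeparatesBelow K (setB a) (setC a) s := by
      refine ⟨fun n hn hB => (hsS n hn).2 ?_, fun n hn hC hbit => ?_⟩
      · exact Theory.model_iff _ |>.1 hM _ (sA_mem_sch hB)
      · have h1 : M ⊨ (∼(sA n) : LE.Sentence) :=
          Theory.model_iff _ |>.1 hM _ (not_sA_mem_sch hC)
        rw [Sentence.Realize, Formula.realize_not] at h1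
        exact h1 ((hsS n hn).1 hbit)
    refine (realize_sentence_iff_of_sameSizes hMK
      (isModelUpTo_stdModel (bits s) le_rfl) (fun n hn => ?_) φ hK.le).2 (h s hs hsep)
    rw [exists_encard_stdModel (by exact_mod_cast hn)]
    rcases n with _ | i
    · refine iff_of_false ?_ (by simp)
      rintro ⟨x, hx⟩
      have : x ∈ eqvClass x := hMK.equivalence.refl x
      rw [Nat.cast_zero, Set.encard_eq_zero] at hx
      rw [hx] at this
      exact this
    · rw [← realize_sA]
      simpa using (hsS i (by omega)).symm

/-- The elements of `stdModel (stdSize (bits s) K)`. -/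
def stdElements (s K : ℕ) : List ℕ :=
  (List.range ((2 * K + 1) * (2 * K + 1))).filter fun x =>
    x.unpair.1 / 2 < K ∧ (x.unpair.1 % 2 = 1 ∧ x.unpair.2 < K ∨
      x.unpair.1 % 2 = 0 ∧ s / 2 ^ (x.unpair.1 / 2) % 2 = 1 ∧
        x.unpair.2 < x.unpair.1 / 2 + 1)

theorem setOf_mem_stdElements (s K : ℕ) :
    {x | x ∈ stdElements s K} = stdModel (stdSize (bits s) K) := by
  ext x
  -- Both coordinates are at most 2`K`, and `Nat.pair` stays below the square of their maximum plus
  -- one.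
  have hb : x.unpair.1 / 2 < K → x.unpair.2 ≤ K → x < (2 * K + 1) * (2 * K + 1) := by
    intro h1 h2
    have := Nat.pair_lt_max_add_one_sq x.unpair.1 x.unpair.2
    rw [Nat.pair_unpair, sq] at this
    have h3 : max x.unpair.1 x.unpair.2 + 1 ≤ 2 * K + 1 := by omega
    exact this.trans_le (Nat.mul_le_mul h3 h3)
  simp only [stdElements, List.mem_filter, List.mem_range, decide_eq_true_iff, stdModel, stdSize,
    Set.mem_ofPred_eq, Nat.cast_lt]
  split_ifs with h1 h2 h3
  · rw [Nat.cast_lt]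
    exact ⟨fun h => by omega, fun h => ⟨hb h1 h.le, h1, .inl ⟨h2, h⟩⟩⟩
  · rw [Nat.cast_lt]
    exact ⟨fun h => by omega, fun h => ⟨hb h1 (by omega), h1, .inr ⟨by omega, h3, h⟩⟩⟩
  · simp only [not_lt_zero, iff_false]
    rintro ⟨-, -, h | h⟩
    exacts [h2 h.1, h3 h.2.1]
  · simp only [not_lt_zero, iff_false]
    exact fun h => h1 h.2.1

theorem realize_congr_set {D D' : Set ℕ} (h : D = D') (φ : LE.Sentence) : D ⊨ φ ↔ D' ⊨ φ := by
  subst h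
  rfl

theorem evalCode_stdElements (s K : ℕ) (φ : LE.Sentence) :
    evalCode (stdElements s K) (formulaCode φ, []) = some true ↔
      stdModel (stdSize (bits s) K) ⊨ φ := by
  classical
  rw [← realize_congr_set (setOf_mem_stdElements s K)]
  have h := evalCode_formulaCode (els := stdElements s K) φ default
  rw [List.ofFn_zero] at h
  rw [h, Option.some_inj, decide_eq_true_iff]
  rfl

theorem stdElements_ne_nil (s : ℕ) {K : ℕ} (hK : 0 < K) : stdElements s K ≠ [] := by
  obtain ⟨x, hx⟩ := nonempty_stdModel (bits s) (κ := K) (by exact_mod_cast hK)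
  rw [← setOf_mem_stdElements] at hx
  exact List.ne_nil_of_mem hx

theorem mem_theorems_sch_iff {a m : ℕ} : m ∈ theorems (sch a) ↔
    ∀ s < 2 ^ (m + 1), SeparatesBelow (m + 1) (setB a) (setC a) s →
      evalCode (stdElements s (m + 1)) (m, []) = some true := by
  constructor
  · rintro ⟨φ, h, rfl⟩ s hs hsep
    exact (evalCode_stdElements _ _ φ).2 ((models_sch_iff (Nat.lt_succ_self _)).1 h s hs hsep)
  · intro h
    -- ℬ itself is a separator, so the quantifier over `s` is not vacuous; one successful evaluation
    -- shows that m is the number of a sentence.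
    obtain ⟨s, hs, hsB⟩ := exists_bits (setB a) (m + 1)
    have hs' := h s hs ⟨fun n hn hB => (hsB n hn).2 hB, fun n hn hC hbit =>
      Set.disjoint_left.1 (disjoint_setB_setC a) ((hsB n hn).1 hbit) hC⟩
    obtain ⟨φ, rfl⟩ := exists_formulaCode_of_evalCode (k := 0)
      (stdElements_ne_nil s m.succ_pos) rfl (by rw [hs']; simp)
    exact ⟨φ, (models_sch_iff (Nat.lt_succ_self _)).2 fun s hs hsep =>
      (evalCode_stdElements _ _ φ).1 (h s hs hsep), rfl⟩

/-- The sentence with number `m` follows from `J` and the part of `sch a` that is known within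
the bound `t`. -/
def FollowsWithin (a m t : ℕ) : Prop :=
  ∀ s < 2 ^ (m + 1), SeparatesBelow (m + 1) (setBIn a t) (setCIn a t) s →
    evalCode (stdElements s (m + 1)) (m, []) = some true

/-- Knowing less of ℬ and 𝒞 leaves more separators to check, so the bounded test is sound at every
stage. -/
theorem FollowsWithin.mem_theorems {a m t : ℕ} (h : FollowsWithin a m t) :
    m ∈ theorems (sch a) :=
  mem_theorems_sch_iff.2 fun s hs hsep => h s hs
    ⟨fun n hn hB => hsep.1 n hn (setBIn_subset a t hB),
      fun n hn hC => hsep.2 n hn (setCIn_subset a t hC)⟩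

theorem mem_theorems_iff_followsWithin_modulus {a m : ℕ} :
    m ∈ theorems (sch a) ↔ FollowsWithin a m (modulus a (m + 1)) := by
  refine ⟨fun h s hs hsep => mem_theorems_sch_iff.1 h s hs ⟨fun n hn hB => hsep.1 n hn ?_,
    fun n hn hC => hsep.2 n hn ?_⟩, FollowsWithin.mem_theorems⟩
  -- Since (n)₀ ≤ n < m + 1, whether n lies in ℬ or 𝒞 is settled once all elements of 𝒜 below m + 1
  -- have appeared.
  · exact mem_setBIn (fun h => haltsIn_modulus ((Nat.unpair_left_le n).trans_lt hn) h) hB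
  · exact mem_setCIn (fun h => haltsIn_modulus ((Nat.unpair_left_le n).trans_lt hn) h) hC

theorem mem_theorems_iff_exists_followsWithin {a m : ℕ} :
    m ∈ theorems (sch a) ↔ ∃ t, FollowsWithin a m t :=
  ⟨fun h => ⟨_, mem_theorems_iff_followsWithin_modulus.1 h⟩, fun ⟨_, h⟩ => h.mem_theorems⟩

/-! ### Primitive recursiveness of the bounded provability test -/

theorem primrec_two_pow : Primrec fun n : ℕ => 2 ^ n :=
  (Primrec₂.unpaired'.1 Nat.Primrec.pow).comp (Primrec.const 2) Primrec.id

theorem primrecRel_mem_bits : PrimrecRel fun s n => n ∈ bits s :=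
  Primrec.eq.comp (Primrec.nat_mod.comp (Primrec.nat_div.comp Primrec.fst
    (primrec_two_pow.comp Primrec.snd)) (Primrec.const 2)) (Primrec.const 1)

theorem primrec_stdElements : Primrec₂ stdElements := by
  have hfst : Primrec fun p : ℕ × ℕ × ℕ => p.1.unpair.1 :=
    Primrec.fst.comp (Primrec.unpair.comp Primrec.fst)
  have hsnd : Primrec fun p : ℕ × ℕ × ℕ => p.1.unpair.2 :=
    Primrec.snd.comp (Primrec.unpair.comp Primrec.fst)
  have hhalf : Primrec fun p : ℕ × ℕ × ℕ => p.1.unpair.1 / 2 :=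
    Primrec.nat_div.comp hfst (Primrec.const 2)
  have hmod : Primrec fun p : ℕ × ℕ × ℕ => p.1.unpair.1 % 2 :=
    Primrec.nat_mod.comp hfst (Primrec.const 2)
  have hs : Primrec fun p : ℕ × ℕ × ℕ => p.2.1 := Primrec.fst.comp Primrec.snd
  have hK : Primrec fun p : ℕ × ℕ × ℕ => p.2.2 := Primrec.snd.comp Primrec.snd
  have h : PrimrecRel fun (x : ℕ) (p : ℕ × ℕ) =>
      x.unpair.1 / 2 < p.2 ∧ (x.unpair.1 % 2 = 1 ∧ x.unpair.2 < p.2 ∨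
      x.unpair.1 % 2 = 0 ∧ p.1 / 2 ^ (x.unpair.1 / 2) % 2 = 1 ∧
        x.unpair.2 < x.unpair.1 / 2 + 1) := by
    refine PrimrecPred.and (Primrec.nat_lt.comp hhalf hK) (PrimrecPred.or
      (PrimrecPred.and (Primrec.eq.comp hmod (Primrec.const 1)) (Primrec.nat_lt.comp hsnd hK))
      (PrimrecPred.and (Primrec.eq.comp hmod (Primrec.const 0))
        (PrimrecPred.and (primrecRel_mem_bits.comp hs hhalf)
          (Primrec.nat_lt.comp hsnd (Primrec.succ.comp hhalf)))))
  have hb : Primrec fun p : ℕ × ℕ => 2 * p.2 + 1 :=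
    Primrec.nat_double_succ.comp Primrec.snd
  exact h.listFilter.comp (Primrec.list_range.comp (Primrec.nat_mul.comp hb hb)) Primrec.id

theorem PrimrecRel.forall_lt_of_primcodable {α : Type*} [Primcodable α] {R : ℕ → α → Prop}
    (hR : PrimrecRel R) : PrimrecRel fun (n : ℕ) (y : α) => ∀ x < n, R x y :=
  (hR.forall_mem_list.comp (Primrec.list_range.comp Primrec.fst) Primrec.snd).of_eq (by simp)

theorem PrimrecPred.imp {α : Type*} [Primcodable α] {p q : α → Prop} (hp : PrimrecPred p)
    (hq : PrimrecPred q) : PrimrecPred fun x => p x → q x :=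
  (hp.not.or hq).of_eq fun _ => imp_iff_not_or.symm

theorem primrecRel_followsWithin (a : ℕ) : PrimrecRel (FollowsWithin a) := by
  have hB : PrimrecRel fun (n : ℕ) (p : ℕ × ℕ × ℕ) => n ∈ setBIn a p.2.2 → n ∈ bits p.1 :=
    PrimrecPred.imp ((primrecRel_mem_setBIn a).comp (Primrec.snd.comp (Primrec.snd.comp
      Primrec.snd)) Primrec.fst) (primrecRel_mem_bits.comp (Primrec.fst.comp Primrec.snd)
      Primrec.fst)
  have hC : PrimrecRel fun (n : ℕ) (p : ℕ × ℕ × ℕ) => n ∈ setCIn a p.2.2 → n ∉ bits p.1 :=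
    PrimrecPred.imp ((primrecRel_mem_setCIn a).comp (Primrec.snd.comp (Primrec.snd.comp
      Primrec.snd)) Primrec.fst) (PrimrecPred.not (primrecRel_mem_bits.comp
      (Primrec.fst.comp Primrec.snd) Primrec.fst))
  have hm : Primrec fun p : ℕ × ℕ × ℕ => p.2.1 + 1 :=
    Primrec.succ.comp (Primrec.fst.comp Primrec.snd)
  have h : PrimrecRel fun (s : ℕ) (p : ℕ × ℕ) =>
      SeparatesBelow (p.1 + 1) (setBIn a p.2) (setCIn a p.2) s →
        evalCode (stdElements s (p.1 + 1)) (p.1, []) = some true := by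
    refine PrimrecPred.imp (PrimrecPred.and ?_ ?_) ?_
    · exact (PrimrecRel.forall_lt_of_primcodable hB).comp hm Primrec.id
    · exact (PrimrecRel.forall_lt_of_primcodable hC).comp hm Primrec.id
    · exact Primrec.eq.comp (primrec_evalCode.comp (primrec_stdElements.comp Primrec.fst hm)
        ((Primrec.fst.comp Primrec.snd).pair (Primrec.const []))) (Primrec.const _)
  exact (PrimrecRel.forall_lt_of_primcodable h).comp
    (primrec_two_pow.comp (Primrec.succ.comp Primrec.fst)) Primrec.id

theorem isRE_theorems_sch (a : ℕ) : IsRE (theorems (sch a)) :=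
  isRE_of_exists (primrecRel_followsWithin a) fun _ => mem_theorems_iff_exists_followsWithin

theorem theorems_sch_reducible (a : ℕ) : SetTuringReducible (theorems (sch a)) (W a) :=
  setTuringReducible_of_modulus (primrecRel_followsWithin a) Computable.succ
    fun _ => mem_theorems_iff_followsWithin_modulus

/-! ### Extensions of `sch a` -/

/-- The set of n for which `V` proves the translated A_n is RE, contains ℬ, and avoids 𝒞 because `V`
is consistent; Shoenfield's lemma applies to it. -/
theorem W_reducible_theorems {a : ℕ} {L' : FirstOrder.Language.{0, 0}}
    [∀ n, Encodable (L'.Functions n)] [∀ n, Encodable (L'.Relations n)] (ι : LE →ᴸ L')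
    {V : L'.Theory} (hV : ∀ φ : LE.Sentence, sch a ⊨ᵇ φ → V ⊨ᵇ ι.onSentence φ)
    (hRE : IsRE (theorems V)) (hsat : V.IsSatisfiable) :
    SetTuringReducible (W a) (theorems V) := by
  have hg : Computable fun n => formulaCode (ι.onSentence (sA n)) :=
    (primrec_sACode _).to_comp.of_eq fun n => (formulaCode_onSentence_sA ι n).symm
  have hZ : IsRE {n | formulaCode (ι.onSentence (sA n)) ∈ theorems V} := isRE_preimage hg hRE
  have hle := setTuringReducible_preimage (T := theorems V) hg
  refine SetTuringReducible.trans (setTuringReducible_of_separates hZ ?_ ?_) hle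
  · intro n hn
    have h1 : V ⊨ᵇ ι.onSentence (sA n) := hV _ (Theory.models_sentence_of_mem (sA_mem_sch hn))
    rwa [Set.mem_ofPred_eq, formulaCode_mem_theorems]
  · refine Set.disjoint_left.2 fun n hn hnZ => ?_
    obtain ⟨M⟩ := hsat
    have h1 : V ⊨ᵇ ι.onSentence (sA n) := by
      rwa [Set.mem_ofPred_eq, formulaCode_mem_theorems] at hnZ
    have h2 : V ⊨ᵇ ι.onSentence (∼(sA n)) :=
      hV _ (Theory.models_sentence_of_mem (not_sA_mem_sch hn))
    have h3 : M ⊨ (∼(ι.onSentence (sA n)) : L'.Sentence) := h2.realize_sentence M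
    rw [Sentence.Realize, Formula.realize_not] at h3
    exact h3 (h1.realize_sentence M)

theorem onSentence_id (φ : LE.Sentence) : (LHom.id LE).onSentence φ = φ :=
  congrFun LHom.id_onBoundedFormula φ

theorem degree_theorems_sch (a : ℕ) : degree (theorems (sch a)) = degree (W a) :=
  degree_eq_iff.2 ⟨theorems_sch_reducible a, W_reducible_theorems (LHom.id LE)
    (fun φ h => by rwa [onSentence_id]) (isRE_theorems_sch a) (isSatisfiable_sch a)⟩

theorem turingPersistent_sch (a : ℕ) : TuringPersistent (sch a) :=
  ⟨isRE_theorems_sch a, isSatisfiable_sch a, fun _ _ _ _ ι _ _ hV hRE hsat =>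
    (theorems_sch_reducible a).trans (W_reducible_theorems ι hV hRE hsat)⟩

/-- A decidable consistent extension would be RE, hence would compute `W a` and make it recursive.
-/
theorem essentiallyUndecidable_sch {a : ℕ} (ha : ¬ IsRecursive (W a)) :
    EssentiallyUndecidable (sch a) := fun _ hV hsat hrec =>
  ha (hrec.of_setTuringReducible (W_reducible_theorems (LHom.id LE)
    (fun φ h => by rw [onSentence_id]; exact hV φ h) hrec.to_re hsat))

end Shoenfield

theorem mainTheorem7 :
    (∀ a : ℕ,
      Shoenfield.degree (Shoenfield.theorems (Shoenfield.sch a)) =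
          Shoenfield.degree (Shoenfield.W a) ∧
        Shoenfield.TuringPersistent (Shoenfield.sch a) ∧
        (¬ Shoenfield.IsRecursive (Shoenfield.W a) →
          Shoenfield.EssentiallyUndecidable (Shoenfield.sch a))) ∧
      ∀ d : TuringDegree,
        (∃ S : Set ℕ, Shoenfield.IsRE S ∧ Shoenfield.degree S = d) →
        d ≠ Shoenfield.degree ∅ →
        ∃ U : Shoenfield.LE.Theory,
          Shoenfield.IsRE (Shoenfield.theorems U) ∧ U.IsSatisfiable ∧
            Shoenfield.EssentiallyUndecidable U ∧
            Shoenfield.degree (Shoenfield.theorems U) = d := by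
  open Shoenfield in
  refine ⟨fun a => ⟨degree_theorems_sch a, turingPersistent_sch a, essentiallyUndecidable_sch⟩, ?_⟩
  rintro _ ⟨S, hS, rfl⟩ hd
  obtain ⟨a, rfl⟩ := hS.exists_index
  refine ⟨sch a, isRE_theorems_sch a, isSatisfiable_sch a, essentiallyUndecidable_sch fun h => hd ?_,
    degree_theorems_sch a⟩
  -- A recursive `W a` would have the degree of ∅, which is excluded.
  exact degree_eq_iff.2 ⟨h.setTuringReducible _, isRecursive_empty.setTuringReducible _⟩
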